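/- Let $\sigma>0$, let $a:[0,1]\to\mathbb R$ be continuous, and let $\xi_1,\xi_2,\dots$ be i.i.d. random variables on a probability space $(\Omega,\mathcal F,P)$ with $P(\xi_1=1)=P(\xi_1=-1)=\tfrac12$. For $H\in(\tfrac12,1)$ put $$c_H=\sqrt{\frac{2H\,\Gamma(\frac32-H)}{\Gamma(H+\frac12)\,\Gamma(2-2H)}},\qquad C_H=c_H\left(H-\tfrac12\right),\qquad k_H(t,s)=C_H\,s^{\frac12-H}\int_s^t u^{H-\frac12}(u-s)^{H-\frac32}\,du.$$ For $1\le i<n$ let $$j_n^H(i)=\sigma C_H\int_{i-1}^{i}x^{\frac12-H}\left(\int_0^1(v+n-1)^{H-\frac12}(v+n-1-x)^{H-\frac32}\,dv\right)dx,$$ and for $n\ge1$ let $$g_n^H=\sigma C_H\int_{n-1}^{n}x^{\frac12-H}(n-x)^{H-\frac12}\left(\int_0^1(y(n-x)+x)^{H-\frac12}y^{H-\frac32}\,dy\right)dx,\qquad \mathcal Y_n^H=\sum_{i=1}^{n-1}j_n^H(i)\,\xi_i .$$ For $1\le n\le N$ and $x\in\{-1,1\}^{n-1}$ let $a_n^{(N)}=\frac1N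 a(n/N)$ and $$J_n^{(N,H)}(i)=\sigma\sqrt N\int_{\frac{i-1}N}^{\frac iN}\left(k_H\left(\tfrac nN,u\right)-k_H\left(\tfrac{n-1}N,u\right)\right)du\quad(1\le i<n),\qquad g_n^{(N,H)}=\sigma\sqrt N\int_{\frac{n-1}N}^{\frac nN}k_H\left(\tfrac nN,u\right)du,$$ $$Y_n^{(N,H)}(x)=\sum_{i=1}^{n-1}J_n^{(N,H)}(i)\,x_i .$$ The point $x\in\{-1,1\}^{n-1}$ is an arbitrage point at level $n$ of the $N$-period fractional binary market if $Y_n^{(N,H)}(x)+g_n^{(N,H)}\le -a_n^{(N)}$ or $Y_n^{(N,H)}(x)-g_n^{(N,H)}\ge -a_n^{(N)}$ (for $n=1$ the only point is the root, and $Y_1^{(N,H)}=0$). Let $\mathcal A_{\mathcal P}^{(N,H)}$ be the set of arbitrage paths, i.e. of those $(x_1,\dots,x_{N-1})\in\{-1,1\}^{N-1}$ for which there is $n\in\{1,\dots,N\}$ such that $(x_1,\dots,x_{n-1})$ is an arbitrage point at level $n$. For events $A_1,A_2,\dots$ write $\{A_n\text{ i.o.}\}=\bigcap_{n\ge1}\bigcup_{k\ge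 n}A_k$ and $\{A_n\text{ ult.}\}=\bigcup_{n\ge1}\bigcap_{k\ge n}A_k$. **Theorem.** There exists $H_c\in(\tfrac12,1)$, not depending on $\sigma$, $a$ or the probability space, such that for every $H\in(H_c,1)$ $$P\left(|\mathcal Y_n^H|>g_n^H\ \text{i.o.}\right)=1,$$ and for every $H\in(\tfrac12,H_c)$ $$P\left(|\mathcal Y_n^H|>g_n^H\ \text{ult.}\right)=0.$$ In particular, for every $H\in(H_c,1)$ $$\lim_{N\to\infty}\frac{|\mathcal A_{\mathcal P}^{(N,H)}|}{2^{N-1}}=1.$$ -/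

import Mathlib

open MeasureTheory ProbabilityTheory Filter Topology Set

noncomputable section

namespace FractionalBinaryMarket

/-- The normalizing constant `c_H`. -/
def cH (H : ℝ) : ℝ :=
  Real.sqrt (2 * H * Real.Gamma (3 / 2 - H) / (Real.Gamma (H + 1 / 2) * Real.Gamma (2 - 2 * H)))

/-- The kernel `k_H(t,s)` of the fractional Brownian motion. -/
def kernelH (H t s : ℝ) : ℝ :=
  cH H * (H - 1 / 2) * s ^ (1 / 2 - H) *
    ∫ u in s..t, u ^ (H - 1 / 2) * (u - s) ^ (H - 3 / 2)

/-! ### The `N`-period fractional binary market -/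

/-- The drift `a_n^{(N)} = a(n/N)/N`. -/
def drift (a : ℝ → ℝ) (N n : ℕ) : ℝ := 1 / (N : ℝ) * a ((n : ℝ) / N)

/-- The coefficient `J_n^{(N,H)}(i)`, for `1 ≤ i < n ≤ N`. -/
def bigJ (σ H : ℝ) (N n i : ℕ) : ℝ :=
  σ * Real.sqrt N * ∫ u in (((i : ℝ) - 1) / N)..((i : ℝ) / N),
    (kernelH H ((n : ℝ) / N) u - kernelH H (((n : ℝ) - 1) / N) u)

/-- The coefficient `g_n^{(N,H)}`, for `1 ≤ n ≤ N`. -/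
def bigG (σ H : ℝ) (N n : ℕ) : ℝ :=
  σ * Real.sqrt N * ∫ u in (((n : ℝ) - 1) / N)..((n : ℝ) / N), kernelH H ((n : ℝ) / N) u

/-- The space `{-1,1}^m`; the group `ℤˣ` of units of the integers is exactly `{-1,1}`.
The coordinate `x_i`, `1 ≤ i ≤ m`, of a point `x` is `x ⟨i - 1, _⟩`. -/
abbrev SignPath (m : ℕ) : Type := Fin m → ℤˣ

/-- `Y_n^{(N,H)}(x_1,…,x_{n-1}) = ∑_{i=1}^{n-1} J_n^{(N,H)}(i) x_i`. -/
def bigY (σ H : ℝ) (N n : ℕ) (x : SignPath (n - 1)) : ℝ :=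
  ∑ i : Fin (n - 1), bigJ σ H N n ((i : ℕ) + 1) * (((x i : ℤˣ) : ℤ) : ℝ)

/-- The upper value `u_n^{(N)}(x)`. -/
def upValue (σ H : ℝ) (N n : ℕ) (x : SignPath (n - 1)) : ℝ := bigY σ H N n x + bigG σ H N n

/-- The lower value `d_n^{(N)}(x)`. -/
def downValue (σ H : ℝ) (N n : ℕ) (x : SignPath (n - 1)) : ℝ := bigY σ H N n x - bigG σ H N n

/-- The set of arbitrage points at level `n`, `1 ≤ n ≤ N`. At level `1` the only candidate is the
root, the unique element of `{-1,1}^0`. -/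
def arbitragePoints (σ : ℝ) (a : ℝ → ℝ) (H : ℝ) (N n : ℕ) : Set (SignPath (n - 1)) :=
  {x | upValue σ H N n x ≤ -drift a N n ∨ -drift a N n ≤ downValue σ H N n x}

/-- The set of arbitrage paths: the paths `(x_1,…,x_{N-1})` such that `(x_1,…,x_{n-1})` is an
arbitrage point at level `n` for at least one `n ∈ {1,…,N}`. -/
def arbitragePaths (σ : ℝ) (a : ℝ → ℝ) (H : ℝ) (N : ℕ) : Set (SignPath (N - 1)) :=
  {x | ∃ (n : ℕ) (hn : 1 ≤ n ∧ n ≤ N),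
    (fun i : Fin (n - 1) => x (Fin.castLE (Nat.sub_le_sub_right hn.2 1) i)) ∈
      arbitragePoints σ a H N n}

/-! ### The rescaled random walk -/

/-- The coefficient `j_n^H(i)`, for `1 ≤ i < n`. -/
def smallJ (σ H : ℝ) (n i : ℕ) : ℝ :=
  σ * (cH H * (H - 1 / 2)) * ∫ x in ((i : ℝ) - 1)..(i : ℝ), x ^ (1 / 2 - H) *
    ∫ v in (0 : ℝ)..1, (v + n - 1) ^ (H - 1 / 2) * (v + n - 1 - x) ^ (H - 3 / 2)

/-- The coefficient `g_n^H`, for `1 ≤ n`. -/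
def smallG (σ H : ℝ) (n : ℕ) : ℝ :=
  σ * (cH H * (H - 1 / 2)) * ∫ x in ((n : ℝ) - 1)..(n : ℝ),
    x ^ (1 / 2 - H) * ((n : ℝ) - x) ^ (H - 1 / 2) *
      ∫ y in (0 : ℝ)..1, (y * (n - x) + x) ^ (H - 1 / 2) * y ^ (H - 3 / 2)

/-- The random variable `𝒴_n^H = ∑_{i=1}^{n-1} j_n^H(i) ξ_i`. The sequence `ξ_1, ξ_2, …` is
enumerated from zero: `ξ k` is `ξ_{k+1}`. -/
def walkY {Ω : Type*} (ξ : ℕ → Ω → ℝ) (σ H : ℝ) (n : ℕ) (ω : Ω) : ℝ :=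
  ∑ i ∈ Finset.range (n - 1), smallJ σ H n (i + 1) * ξ i ω

/-- The random variables `ξ_1, ξ_2, …` are i.i.d. with `P(ξ_1 = -1) = P(ξ_1 = 1) = 1/2`. -/
structure IsIIDSigns {Ω : Type*} [MeasurableSpace Ω] (ξ : ℕ → Ω → ℝ) (P : Measure Ω) : Prop where
  measurable : ∀ k, Measurable (ξ k)
  indep : iIndepFun ξ P
  prob_one : ∀ k, P {ω | ξ k ω = 1} = 1 / 2
  prob_neg_one : ∀ k, P {ω | ξ k ω = -1} = 1 / 2

/-- The event `{A_n i.o.}` for a sequence of sets `A_1, A_2, …`. -/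
def infinitelyOften {Ω : Type*} (A : ℕ → Set Ω) : Set Ω := ⋂ n ≥ 1, ⋃ k ≥ n, A k

/-- The event `{A_n ult.}` for a sequence of sets `A_1, A_2, …`. -/
def ultimately {Ω : Type*} (A : ℕ → Set Ω) : Set Ω := ⋃ n ≥ 1, ⋂ k ≥ n, A k

end FractionalBinaryMarket

end

/-! Both almost sure statements hold for every `H` in `(1/2, 1)`, so there is no genuine threshold
and any interior value serves as `Hc`. Put `a = H - 1/2 ∈ (0, 1/2)`. Up to the common factor `K = σ
c_H a`, the walk has coefficients `walkWeight a n i` and the barrier is `stepWeight a n`.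

Four analytic facts suffice. The barrier lies between `1/(a(a+1))` and `2/a` for `n ≥ 2`. The last
`L` weights add up to at least `L^a / 2`, which is unbounded in `L` (`exists_le_sum_last_weights`).
For fixed `L` and large `n` each of these weights is at most the barrier (`last_weights_le`). The
squares of the weights other than the last have a sum bounded uniformly in `n`, because `2a - 2 <
-1` (`sum_sq_walkWeight_le`), and each fixed weight tends to zero.

Given the past, the last `L` signs follow any prescribed pattern with probability `2^(-L)`. Taking
them all equal pushes the walk beyond the barrier, whatever its earlier part. Conversely,
Chebyshev's inequality keeps the earlier part bounded with probability at least `1/2`, and signs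
chosen greedily against the partial sum then bring the walk inside the barrier. Hence leaving and
returning both have conditional probability at least some `δ > 0`, uniformly over events of any
fixed past, and testing at successive, widely separated times gives failure probability at most `(1
- δ)^k`.

For the market, homogeneity of the kernel gives `J = N^(-H) j` and `g^(N) = N^(-H) g`. The drift is
`O(1/N)`, negligible against `N^(-H)`, so a walk exceeding the barrier by `1` yields an arbitrage
point. The estimate `(1 - δ)^k` is reached within a finite horizon not depending on `N`, which gives
the limit of the proportions. -/

namespace FractionalBinaryMarket

/-! ### Conditional probabilities for i.i.d. signs, and Chebyshev's inequality. -/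

section Probability

/-- The σ-algebra generated by the coordinates with index in `S`. -/
abbrev coordSigma {Ω : Type*} (ξ : ℕ → Ω → ℝ) (S : Set ℕ) : MeasurableSpace Ω :=
  ⨆ i ∈ S, MeasurableSpace.comap (ξ i) inferInstance

/-- The event that the signs with indices `p, …, p + L - 1` follow the pattern `e`. -/
def patternEvent {Ω : Type*} (ξ : ℕ → Ω → ℝ) (p L : ℕ) (e : Fin L → ℤˣ) : Set Ω :=
  {ω | ∀ l : Fin L, ξ (p + l) ω = ((e l : ℤ) : ℝ)}

variable {Ω : Type*}

lemma measurable_coordSigma {ξ : ℕ → Ω → ℝ} {S : Set ℕ} {i : ℕ} (hi : i ∈ S) :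
    Measurable[coordSigma ξ S] (ξ i) := by
  have h : MeasurableSpace.comap (ξ i) inferInstance ≤ coordSigma ξ S :=
    le_iSup₂_of_le (f := fun i (_ : i ∈ S) => MeasurableSpace.comap (ξ i) inferInstance) i hi le_rfl
  exact (comap_measurable (ξ i)).mono h le_rfl

lemma measurable_sum_coordSigma {ξ : ℕ → Ω → ℝ} {S : Set ℕ} (c : ℕ → ℝ) (s : Finset ℕ)
    (hs : ∀ i ∈ s, i ∈ S) :
    Measurable[coordSigma ξ S] (fun ω => ∑ i ∈ s, c i * ξ i ω) :=
  Finset.measurable_fun_sum s fun i hi => (measurable_coordSigma (hs i hi)).const_mul (c i)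

lemma coordSigma_mono (ξ : ℕ → Ω → ℝ) {S T : Set ℕ} (h : S ⊆ T) :
    coordSigma ξ S ≤ coordSigma ξ T :=
  biSup_mono h

lemma measurableSet_patternEvent (ξ : ℕ → Ω → ℝ) (p L : ℕ) (e : Fin L → ℤˣ) :
    MeasurableSet[coordSigma ξ (Ici p)] (patternEvent ξ p L e) := by
  have : patternEvent ξ p L e = ⋂ l : Fin L, ξ (p + l) ⁻¹' {((e l : ℤ) : ℝ)} := by
    ext ω; simp [patternEvent]
  rw [this]
  exact MeasurableSet.iInter fun l =>
    (measurable_coordSigma (show p + (l : ℕ) ∈ Ici p by simp)) (measurableSet_singleton _)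

lemma disjoint_patternEvent (ξ : ℕ → Ω → ℝ) (p L : ℕ) {e e' : Fin L → ℤˣ} (hne : e ≠ e') :
    Disjoint (patternEvent ξ p L e) (patternEvent ξ p L e') := by
  rw [Set.disjoint_left]
  intro ω h1 h2
  apply hne
  funext l
  have := (h1 l).symm.trans (h2 l)
  exact Units.ext (by exact_mod_cast this)

variable [MeasurableSpace Ω] {P : Measure Ω} {ξ : ℕ → Ω → ℝ}

lemma IsIIDSigns.coordSigma_le (h : IsIIDSigns ξ P) (S : Set ℕ) :
    coordSigma ξ S ≤ ‹MeasurableSpace Ω› :=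
  iSup₂_le fun i _ => (h.measurable i).comap_le

lemma IsIIDSigns.indep_coordSigma (h : IsIIDSigns ξ P) {S T : Set ℕ} (hST : Disjoint S T) :
    Indep (coordSigma ξ S) (coordSigma ξ T) P :=
  indep_iSup_of_disjoint (fun i => (h.measurable i).comap_le) h.indep hST

lemma IsIIDSigns.prob_pattern (h : IsIIDSigns ξ P) (p L : ℕ) (e : Fin L → ℤˣ) :
    P (patternEvent ξ p L e) = (1 / 2) ^ L := by
  have : patternEvent ξ p L e = ⋂ l : Fin L, ξ (p + l) ⁻¹' {((e l : ℤ) : ℝ)} := by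
    ext ω; simp [patternEvent]
  have hinj : Function.Injective fun l : Fin L => p + (l : ℕ) := fun a b hab => by
    ext; simpa using hab
  rw [this, (h.indep.precomp hinj).meas_iInter
    (fun l => ⟨_, measurableSet_singleton _, rfl⟩)]
  rw [Finset.prod_congr rfl (g := fun _ => (1 / 2 : ENNReal))]
  · simp
  · intro l _
    rcases Int.units_eq_one_or (e l) with he | he
    · rw [he]; simpa [preimage] using h.prob_one (p + l)
    · rw [he]; simpa [preimage] using h.prob_neg_one (p + l)

lemma IsIIDSigns.prob_inter_pattern (h : IsIIDSigns ξ P) (p L : ℕ) (e : Fin L → ℤˣ) {Q : Set Ω}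
    (hQ : MeasurableSet[coordSigma ξ (Iio p)] Q) :
    P.real (Q ∩ patternEvent ξ p L e) = P.real Q * (1 / 2) ^ L := by
  have hind := h.indep_coordSigma (S := Iio p) (T := Ici p)
    (by rw [Set.disjoint_left]; intro x hx hx'; simp at hx hx'; omega)
  have := (Indep_iff _ _ P).1 hind Q _ hQ (measurableSet_patternEvent ξ p L e)
  rw [measureReal_def, this, h.prob_pattern, ENNReal.toReal_mul, measureReal_def]
  simp

variable [IsProbabilityMeasure P]

/-- If from every value of `R` in `I` some choice of the next `L` signs steers the sum into `D`,
then this happens with conditional probability at least `2 ^ (-L)`. -/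
lemma IsIIDSigns.prob_steer (h : IsIIDSigns ξ P) (p L : ℕ) (c : Fin L → ℝ) {R : Ω → ℝ}
    (hR : Measurable[coordSigma ξ (Iio p)] R) {I D : Set ℝ}
    (hD : MeasurableSet D)
    (hsteer : ∀ r ∈ I, ∃ e : Fin L → ℤˣ, r + ∑ l, c l * ((e l : ℤ) : ℝ) ∈ D) {G : Set Ω}
    (hG : MeasurableSet[coordSigma ξ (Iio p)] G) :
    (1 / 2) ^ L * P.real (G ∩ R ⁻¹' I) ≤
      P.real (G ∩ {ω | R ω + ∑ l : Fin L, c l * ξ (p + l) ω ∈ D}) := by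
  classical
  -- `Q e` is the past event on which the pattern `e` leads into `D`. These events may overlap, but
  -- their intersections with the pattern events are disjoint, and each intersection has probability
  -- `P(Q e) 2^(-L)`.
  set Q : (Fin L → ℤˣ) → Set Ω := fun e =>
    G ∩ R ⁻¹' {r | r + ∑ l, c l * ((e l : ℤ) : ℝ) ∈ D} with hQdef
  have hQ : ∀ e, MeasurableSet[coordSigma ξ (Iio p)] (Q e) := fun e =>
    MeasurableSet.inter hG (hR ((measurable_id.add_const _) hD))
  have hle := h.coordSigma_le
  have hsub : (⋃ e, Q e ∩ patternEvent ξ p L e) ⊆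
      G ∩ {ω | R ω + ∑ l : Fin L, c l * ξ (p + l) ω ∈ D} := by
    intro ω hω
    obtain ⟨e, ⟨hωG, hωR⟩, hωe⟩ := mem_iUnion.1 hω
    refine ⟨hωG, ?_⟩
    have : ∑ l : Fin L, c l * ξ (p + l) ω = ∑ l, c l * ((e l : ℤ) : ℝ) :=
      Finset.sum_congr rfl fun l _ => by rw [hωe l]
    change R ω + _ ∈ D
    rw [this]
    exact hωR
  have hcover : G ∩ R ⁻¹' I ⊆ ⋃ e ∈ (Finset.univ : Finset (Fin L → ℤˣ)), Q e := by
    intro ω hω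
    obtain ⟨e, he⟩ := hsteer _ hω.2
    exact mem_iUnion₂.2 ⟨e, Finset.mem_univ _, hω.1, he⟩
  have hunion : P.real (⋃ e, Q e ∩ patternEvent ξ p L e) = ∑ e, P.real (Q e) * (1 / 2) ^ L := by
    rw [measureReal_iUnion_fintype]
    · exact Finset.sum_congr rfl fun e _ => h.prob_inter_pattern p L e (hQ e)
    · intro e e' hne
      exact (disjoint_patternEvent ξ p L hne).mono inter_subset_right inter_subset_right
    · exact fun e => (hle _ _ (hQ e)).inter (hle _ _ (measurableSet_patternEvent ξ p L e))
  calc (1 / 2 : ℝ) ^ L * P.real (G ∩ R ⁻¹' I)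
      ≤ (1 / 2) ^ L * ∑ e, P.real (Q e) := by
        gcongr
        exact (measureReal_mono hcover (measure_ne_top _ _)).trans (measureReal_biUnion_finset_le _ _)
    _ = P.real (⋃ e, Q e ∩ patternEvent ξ p L e) := by
        rw [hunion, ← Finset.sum_mul, mul_comm]
    _ ≤ _ := measureReal_mono hsub

/-- If, conditionally on the past up to any time, all sufficiently late events `A n` have
probability at least `δ`, then almost surely some late event occurs. -/
lemma exists_prob_iInter_compl_le (h : IsIIDSigns ξ P) {A : ℕ → Set Ω} {δ : ℝ} (hδ1 : δ ≤ 1)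
    (hA : ∀ n, MeasurableSet[coordSigma ξ (Iio n)] (A n))
    (hcond : ∀ m, ∃ n₀, ∀ n ≥ n₀, ∀ G, MeasurableSet[coordSigma ξ (Iio m)] G →
      δ * P.real G ≤ P.real (G ∩ A n)) (n₀ k : ℕ) :
    ∃ N, P.real (⋂ n ∈ Finset.Ico n₀ N, (A n)ᶜ) ≤ (1 - δ) ^ k := by
  have hle := h.coordSigma_le
  induction k with
  | zero => exact ⟨0, by simp⟩
  | succ k ih =>
    obtain ⟨N, hN⟩ := ih
    set G := ⋂ n ∈ Finset.Ico n₀ N, (A n)ᶜ with hGdef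
    have hG : MeasurableSet[coordSigma ξ (Iio N)] G := by
      refine Finset.measurableSet_biInter _ fun n hn => MeasurableSet.compl ?_
      refine coordSigma_mono ξ ?_ _ (hA n)
      exact Iio_subset_Iio (Finset.mem_Ico.1 hn).2.le
    -- `G` is decided before time `N`, so a sufficiently late event `A n` removes at least the
    -- fraction `δ` of it. One more factor `1 - δ` is gained at the price of a larger horizon.
    obtain ⟨n₁, hn₁⟩ := hcond N
    set n := max n₁ (max n₀ N) with hn
    have hn1 : n₁ ≤ n := le_max_left _ _
    have hn2 : n₀ ≤ n := (le_max_left _ _).trans (le_max_right _ _)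
    have hn3 : N ≤ n := (le_max_right _ _).trans (le_max_right _ _)
    refine ⟨n + 1, ?_⟩
    have hsub : (⋂ i ∈ Finset.Ico n₀ (n + 1), (A i)ᶜ) ⊆ G \ A n := by
      intro ω hω
      rw [mem_iInter₂] at hω
      refine ⟨mem_iInter₂.2 fun i hi => hω i ?_, hω n ?_⟩
      · rw [Finset.mem_Ico] at hi ⊢; omega
      · rw [Finset.mem_Ico]; omega
    have hdiff := measureReal_inter_add_sdiff (μ := P) (s := G) (hle _ _ (hA n))
    have := hn₁ n hn1 G hG
    calc P.real (⋂ i ∈ Finset.Ico n₀ (n + 1), (A i)ᶜ) ≤ P.real (G \ A n) := measureReal_mono hsub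
      _ ≤ (1 - δ) * P.real G := by linarith
      _ ≤ (1 - δ) * (1 - δ) ^ k := by gcongr
      _ = (1 - δ) ^ (k + 1) := by ring

lemma prob_iInter_compl_eq_zero (h : IsIIDSigns ξ P) {A : ℕ → Set Ω} {δ : ℝ} (hδ : 0 < δ)
    (hδ1 : δ ≤ 1) (hA : ∀ n, MeasurableSet[coordSigma ξ (Iio n)] (A n))
    (hcond : ∀ m, ∃ n₀, ∀ n ≥ n₀, ∀ G, MeasurableSet[coordSigma ξ (Iio m)] G →
      δ * P.real G ≤ P.real (G ∩ A n)) (n₀ : ℕ) :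
    P (⋂ n ≥ n₀, (A n)ᶜ) = 0 := by
  rw [← measureReal_eq_zero_iff]
  refine le_antisymm ?_ measureReal_nonneg
  refine ge_of_tendsto' (tendsto_pow_atTop_nhds_zero_of_lt_one (by linarith : 0 ≤ 1 - δ)
    (by linarith)) fun k => ?_
  obtain ⟨N, hN⟩ := exists_prob_iInter_compl_le h hδ1 hA hcond n₀ k
  refine (measureReal_mono ?_).trans hN
  intro ω hω
  rw [mem_iInter₂] at hω ⊢
  exact fun n hn => hω n (Finset.mem_Ico.1 hn).1

lemma IsIIDSigns.ae_sign (h : IsIIDSigns ξ P) (k : ℕ) :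
    ∀ᵐ ω ∂P, ξ k ω = 1 ∨ ξ k ω = -1 := by
  have h1 : MeasurableSet {ω | ξ k ω = 1} := h.measurable k (measurableSet_singleton 1)
  have h2 : MeasurableSet {ω | ξ k ω = -1} := h.measurable k (measurableSet_singleton (-1))
  have hd : Disjoint {ω | ξ k ω = 1} {ω | ξ k ω = -1} := by
    rw [Set.disjoint_left]; intro ω ha hb
    simp only [mem_ofPred_eq] at ha hb; linarith
  have : P ({ω | ξ k ω = 1} ∪ {ω | ξ k ω = -1}) = 1 := by
    rw [measure_union hd h2, h.prob_one, h.prob_neg_one, ENNReal.add_halves]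
  exact (mem_ae_iff_prob_eq_one (h1.union h2)).2 this

lemma IsIIDSigns.memLp (h : IsIIDSigns ξ P) (k : ℕ) : MemLp (ξ k) 2 P := by
  refine MemLp.of_bound (h.measurable k).aestronglyMeasurable 1 ?_
  filter_upwards [h.ae_sign k] with ω hω
  rcases hω with hω | hω <;> simp [hω]

lemma IsIIDSigns.integral_eq_zero (h : IsIIDSigns ξ P) (k : ℕ) : ∫ ω, ξ k ω ∂P = 0 := by
  have h1 : MeasurableSet {ω | ξ k ω = 1} := h.measurable k (measurableSet_singleton 1)
  have h2 : MeasurableSet {ω | ξ k ω = -1} := h.measurable k (measurableSet_singleton (-1))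
  have heq : ξ k =ᵐ[P] fun ω => {ω | ξ k ω = 1}.indicator (fun _ => (1 : ℝ)) ω -
      {ω | ξ k ω = -1}.indicator (fun _ => (1 : ℝ)) ω := by
    filter_upwards [h.ae_sign k] with ω hω
    rcases hω with hω | hω
    · simp [indicator, hω]; norm_num
    · simp [indicator, hω]; norm_num
  rw [integral_congr_ae heq, integral_sub, integral_indicator_const _ h1,
    integral_indicator_const _ h2, measureReal_def, measureReal_def, h.prob_one, h.prob_neg_one]
  · simp
  · exact (integrable_const _).indicator h1
  · exact (integrable_const _).indicator h2

lemma IsIIDSigns.variance_eq_one (h : IsIIDSigns ξ P) (k : ℕ) : variance (ξ k) P = 1 := by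
  rw [variance_of_integral_eq_zero (h.measurable k).aemeasurable (h.integral_eq_zero k)]
  have : (fun ω => ξ k ω ^ 2) =ᵐ[P] fun _ => 1 := by
    filter_upwards [h.ae_sign k] with ω hω
    rcases hω with hω | hω <;> simp [hω]
  simp [integral_congr_ae this]

lemma IsIIDSigns.variance_sum (h : IsIIDSigns ξ P) (c : ℕ → ℝ) (s : Finset ℕ) :
    variance (∑ i ∈ s, fun ω => c i * ξ i ω) P = ∑ i ∈ s, c i ^ 2 := by
  rw [IndepFun.variance_sum (fun i _ => (h.memLp i).const_mul (c i))]
  · exact Finset.sum_congr rfl fun i _ => by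
      rw [variance_const_mul, h.variance_eq_one, mul_one]
  · intro i _ j _ hij
    exact (h.indep.indepFun hij).comp (measurable_const_mul (c i)) (measurable_const_mul (c j))

/-- Chebyshev's inequality for a weighted sum of signs. -/
lemma IsIIDSigns.half_le_prob_abs_sum_le (h : IsIIDSigns ξ P) (c : ℕ → ℝ) (s : Finset ℕ) {M : ℝ}
    (hM : 0 < M) (hc : 2 * ∑ i ∈ s, c i ^ 2 ≤ M ^ 2) :
    1 / 2 ≤ P.real {ω | |∑ i ∈ s, c i * ξ i ω| ≤ M} := by
  set Z : Ω → ℝ := ∑ i ∈ s, fun ω => c i * ξ i ω with hZ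
  have hZapp : ∀ ω, Z ω = ∑ i ∈ s, c i * ξ i ω := fun ω => by simp [hZ]
  have hmem : MemLp Z 2 P := memLp_finsetSum' s fun i _ => (h.memLp i).const_mul (c i)
  have hmean : ∫ ω, Z ω ∂P = 0 := by
    simp_rw [hZapp]
    rw [integral_finsetSum _ fun i _ => ((h.memLp i).integrable (by norm_num)).const_mul (c i)]
    simp [integral_const_mul, h.integral_eq_zero]
  have hmeas : Measurable Z := by
    have : Z = fun ω => ∑ i ∈ s, c i * ξ i ω := funext hZapp
    rw [this]
    exact Finset.measurable_fun_sum s fun i _ => (h.measurable i).const_mul (c i)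
  have hcheb := meas_ge_le_variance_div_sq hmem hM
  rw [hmean, h.variance_sum] at hcheb
  simp only [sub_zero] at hcheb
  have hbad : P.real {ω | M ≤ |Z ω|} ≤ 1 / 2 := by
    refine (ENNReal.toReal_mono ENNReal.ofReal_ne_top hcheb).trans ?_
    rw [ENNReal.toReal_ofReal (by positivity), div_le_div_iff₀ (by positivity) (by norm_num)]
    linarith
  have hcompl : P.real {ω | M ≤ |Z ω|}ᶜ = 1 - P.real {ω | M ≤ |Z ω|} :=
    probReal_compl_eq_one_sub (measurableSet_le measurable_const hmeas.abs)
  calc (1 / 2 : ℝ) ≤ P.real {ω | M ≤ |Z ω|}ᶜ := by rw [hcompl]; linarith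
    _ ≤ _ := measureReal_mono fun ω hω => by
      simp only [mem_compl_iff, mem_ofPred_eq, not_le] at hω ⊢
      rw [← hZapp]; exact hω.le

end Probability

/-! ### Choosing the last signs so as to leave or enter an interval. -/

section Steering

/-- All signs equal push the sum away from zero. -/
lemma exists_signs_le_abs {L : ℕ} (c : Fin L → ℝ) {T : ℝ} (hT : T ≤ ∑ l, c l) (r : ℝ) :
    ∃ e : Fin L → ℤˣ, T ≤ |r + ∑ l, c l * ((e l : ℤ) : ℝ)| := by
  rcases le_total 0 r with hr | hr
  · refine ⟨fun _ => 1, ?_⟩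
    simp only [Units.val_one, Int.cast_one, mul_one]
    exact le_trans (by linarith) (le_abs_self _)
  · refine ⟨fun _ => -1, ?_⟩
    simp only [Units.val_neg, Units.val_one, Int.cast_neg, Int.cast_one, mul_neg, mul_one,
      Finset.sum_neg_distrib]
    exact le_trans (by linarith) (neg_le_abs _)

/-- Choosing each sign against the current partial sum keeps the sum small. -/
lemma exists_signs_abs_le {g : ℝ} : ∀ {L : ℕ} (c : Fin L → ℝ), (∀ l, 0 ≤ c l) → (∀ l, c l ≤ g) →
    ∀ r : ℝ, ∃ e : Fin L → ℤˣ, |r + ∑ l, c l * ((e l : ℤ) : ℝ)| ≤ max g (|r| - ∑ l, c l)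
  | 0, _, _, _, r => ⟨fun _ => 1, by simp⟩
  | L + 1, c, h0, hg, r => by
    -- A step of length `c 0 ≤ g` towards zero either shortens `|r|` by `c 0`, or crosses zero and
    -- lands within `g`.
    obtain ⟨s, hs⟩ : ∃ s : ℤˣ, |r + c 0 * ((s : ℤ) : ℝ)| ≤ max g (|r| - c 0) := by
      have h1 := h0 0
      have h2 := hg 0
      rcases le_total 0 r with hr | hr
      · refine ⟨-1, ?_⟩
        simp only [Units.val_neg, Units.val_one, Int.cast_neg, Int.cast_one, mul_neg, mul_one,
          abs_of_nonneg hr]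
        rw [abs_le, le_max_iff, neg_le, le_max_iff]
        exact ⟨Or.inl (by linarith), Or.inr (by linarith)⟩
      · refine ⟨1, ?_⟩
        simp only [Units.val_one, Int.cast_one, mul_one, abs_of_nonpos hr]
        rw [abs_le, le_max_iff, neg_le, le_max_iff]
        exact ⟨Or.inr (by linarith), Or.inl (by linarith)⟩
    obtain ⟨e, he⟩ := exists_signs_abs_le (fun l => c l.succ) (fun l => h0 _) (fun l => hg _)
      (r + c 0 * ((s : ℤ) : ℝ))
    have hrest : 0 ≤ ∑ l : Fin L, c l.succ := Finset.sum_nonneg fun l _ => h0 _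
    refine ⟨Fin.cons s e, ?_⟩
    rw [Fin.sum_univ_succ, Fin.sum_univ_succ]
    simp only [Fin.cons_zero, Fin.cons_succ]
    rw [← add_assoc]
    refine he.trans ?_
    rw [max_le_iff]
    refine ⟨le_max_left _ _, ?_⟩
    rcases le_max_iff.1 hs with hs | hs
    · exact le_trans (by linarith) (le_max_left _ _)
    · exact le_trans (by linarith) (le_max_right _ _)

variable {Ω : Type*} {ξ : ℕ → Ω → ℝ}

lemma sum_range_split (b : ℕ → ℝ) (ω : Ω) {n p L : ℕ} (h : p + L = n) :
    ∑ i ∈ Finset.range n, b i * ξ i ω =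
      ∑ i ∈ Finset.range p, b i * ξ i ω + ∑ l : Fin L, b (p + l) * ξ (p + l) ω := by
  subst h
  rw [Finset.sum_range_add, Finset.sum_range (n := L)]

variable [MeasurableSpace Ω] {P : Measure Ω} [IsProbabilityMeasure P]

/-- Conditionally on the past, a weighted sum of signs whose last `L` weights add up to at least
`T` has absolute value at least `T` with probability at least `2 ^ (-L)`. -/
lemma IsIIDSigns.prob_le_abs_sum (h : IsIIDSigns ξ P) (b : ℕ → ℕ → ℝ) {L : ℕ} {T : ℝ} {n₁ : ℕ}
    (hT : ∀ n ≥ n₁, T ≤ ∑ l : Fin L, b n (n - 1 - L + l)) (m : ℕ) :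
    ∃ n₀, ∀ n ≥ n₀, ∀ G, MeasurableSet[coordSigma ξ (Iio m)] G →
      (1 / 2) ^ L * P.real G ≤
        P.real (G ∩ {ω | T ≤ |∑ i ∈ Finset.range (n - 1), b n i * ξ i ω|}) := by
  -- With `n ≥ m + L + 1` the steered block starts at `n - 1 - L ≥ m`, after everything that `G`
  -- depends on, and the subtraction in `ℕ` is not truncated.
  refine ⟨max n₁ (m + L + 1), fun n hn G hG => ?_⟩
  have hn1 : n₁ ≤ n := (le_max_left _ _).trans hn
  have hn2 : m + L + 1 ≤ n := (le_max_right _ _).trans hn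
  obtain ⟨p, hp⟩ : ∃ p, p = n - 1 - L := ⟨_, rfl⟩
  have hsum := hT n hn1
  rw [← hp] at hsum
  have key := h.prob_steer p L (fun l => b n (p + l))
    (R := fun ω => ∑ i ∈ Finset.range p, b n i * ξ i ω)
    (measurable_sum_coordSigma _ _ fun i hi => Finset.mem_range.1 hi) (I := univ)
    (D := {y | T ≤ |y|}) (measurableSet_le measurable_const measurable_id.abs)
    (fun r _ => exists_signs_le_abs _ hsum r)
    (coordSigma_mono ξ (Iio_subset_Iio (by omega)) _ hG)
  rw [preimage_univ, inter_univ] at key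
  refine key.trans (le_of_eq ?_)
  congr 2
  ext ω
  simp only [mem_ofPred_eq, sum_range_split (b n) ω (show p + L = n - 1 by omega)]

/-- Conditionally on the past, a weighted sum of signs with square-summable weights is smaller than
`g n` with probability bounded below, if the last `L` weights are at most `g n` and add up to
sufficiently much. -/
lemma IsIIDSigns.prob_abs_sum_le (h : IsIIDSigns ξ P) (b : ℕ → ℕ → ℝ) (g : ℕ → ℝ) {L : ℕ}
    {V M : ℝ} {n₁ : ℕ} (hM : 0 < M) (hV : 2 * V ≤ M ^ 2)
    (hsum : ∀ n ≥ n₁, M + 1 ≤ ∑ l : Fin L, b n (n - 1 - L + l))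
    (hb0 : ∀ n ≥ n₁, ∀ l : Fin L, 0 ≤ b n (n - 1 - L + l))
    (hbg : ∀ n ≥ n₁, ∀ l : Fin L, b n (n - 1 - L + l) ≤ g n)
    (hsq : ∀ n ≥ n₁, ∑ i ∈ Finset.range (n - 1 - L), b n i ^ 2 ≤ V)
    (hfix : ∀ m, ∀ᶠ n in atTop, ∑ i ∈ Finset.range m, |b n i| ≤ 1) (hg : ∀ n ≥ n₁, 0 ≤ g n)
    (m : ℕ) :
    ∃ n₀, ∀ n ≥ n₀, ∀ G, MeasurableSet[coordSigma ξ (Iio m)] G →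
      (1 / 2) ^ (L + 1) * P.real G ≤
        P.real (G ∩ {ω | |∑ i ∈ Finset.range (n - 1), b n i * ξ i ω| ≤ g n}) := by
  obtain ⟨n₂, hn₂⟩ := eventually_atTop.1 (hfix m)
  refine ⟨max n₁ (max n₂ (m + L + 1)), fun n hn G hG => ?_⟩
  have hn1 : n₁ ≤ n := (le_max_left _ _).trans hn
  have hn2 : n₂ ≤ n := (le_max_left _ _).trans ((le_max_right _ _).trans hn)
  have hn3 : m + L + 1 ≤ n := (le_max_right _ _).trans ((le_max_right _ _).trans hn)
  have hfixn := hn₂ n hn2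
  have hsqn := hsq n hn1
  have hsumn := hsum n hn1
  have hb0n := hb0 n hn1
  have hbgn := hbg n hn1
  obtain ⟨p, hp⟩ : ∃ p, p = n - 1 - L := ⟨_, rfl⟩
  rw [← hp] at hsqn hsumn hb0n hbgn
  have hmp : m ≤ p := by omega
  have key := h.prob_steer p L (fun l => b n (p + l))
    (R := fun ω => ∑ i ∈ Finset.range p, b n i * ξ i ω)
    (measurable_sum_coordSigma _ _ fun i hi => Finset.mem_range.1 hi) (I := {r | |r| ≤ M + 1})
    (D := {y | |y| ≤ g n}) (measurableSet_le measurable_id.abs measurable_const)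
    (fun r hr => by
      obtain ⟨e, he⟩ := exists_signs_abs_le _ hb0n hbgn r
      refine ⟨e, he.trans (max_le le_rfl ?_)⟩
      have hr' : |r| ≤ M + 1 := hr
      have := hg n hn1
      linarith)
    (coordSigma_mono ξ (Iio_subset_Iio hmp) _ hG)
  -- The indices split into three blocks. Those below `m` may be correlated with `G` but contribute
  -- at most `1`. Those in `[m, p)` are independent of `G` and contribute at most `M` with
  -- probability at least `1/2`. The remaining `L` are steered, which produces the total factor
  -- `2^(-(L+1))`.
  have hmid : MeasurableSet[coordSigma ξ (Ici m)]
      {ω | |∑ i ∈ Finset.Ico m p, b n i * ξ i ω| ≤ M} :=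
    (measurable_sum_coordSigma (S := Ici m) (b n) _ fun i hi => (Finset.mem_Ico.1 hi).1)
      (measurableSet_le (measurable_id.abs) measurable_const : MeasurableSet {y : ℝ | |y| ≤ M})
  have hind := (Indep_iff _ _ P).1 (h.indep_coordSigma (S := Iio m) (T := Ici m)
    (by rw [Set.disjoint_left]; intro x hx hx'; simp at hx hx'; omega)) G _ hG hmid
  have hcheb := h.half_le_prob_abs_sum_le (b n) (Finset.Ico m p) hM (by
    refine le_trans ?_ hV
    refine mul_le_mul_of_nonneg_left (le_trans ?_ hsqn) (by norm_num)
    refine Finset.sum_le_sum_of_subset_of_nonneg ?_ fun _ _ _ => sq_nonneg _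
    intro i hi
    exact Finset.mem_range.2 (Finset.mem_Ico.1 hi).2)
  have hsigns : ∀ᵐ ω ∂P, ∀ k, ξ k ω = 1 ∨ ξ k ω = -1 := ae_all_iff.2 h.ae_sign
  have hR : P.real (G ∩ {ω | |∑ i ∈ Finset.Ico m p, b n i * ξ i ω| ≤ M}) ≤
      P.real (G ∩ (fun ω => ∑ i ∈ Finset.range p, b n i * ξ i ω) ⁻¹' {r | |r| ≤ M + 1}) := by
    refine ENNReal.toReal_mono (measure_ne_top _ _) (measure_mono_ae ?_)
    filter_upwards [hsigns] with ω hω hωG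
    refine ⟨hωG.1, ?_⟩
    have h1 : |∑ i ∈ Finset.Ico m p, b n i * ξ i ω| ≤ M := hωG.2
    have h2 : |∑ i ∈ Finset.range m, b n i * ξ i ω| ≤ 1 := by
      refine (Finset.abs_sum_le_sum_abs _ _).trans (le_trans (le_of_eq ?_) hfixn)
      refine Finset.sum_congr rfl fun i _ => ?_
      rcases hω i with hi | hi <;> simp [hi]
    change |∑ i ∈ Finset.range p, b n i * ξ i ω| ≤ M + 1
    rw [← Finset.sum_range_add_sum_Ico _ hmp]
    exact (abs_add_le _ _).trans (by linarith)
  have hprod : P.real (G ∩ {ω | |∑ i ∈ Finset.Ico m p, b n i * ξ i ω| ≤ M}) =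
      P.real G * P.real {ω | |∑ i ∈ Finset.Ico m p, b n i * ξ i ω| ≤ M} := by
    rw [measureReal_def, hind, ENNReal.toReal_mul]; rfl
  calc (1 / 2 : ℝ) ^ (L + 1) * P.real G = (1 / 2) ^ L * (P.real G * (1 / 2)) := by ring
    _ ≤ (1 / 2) ^ L * P.real
        (G ∩ (fun ω => ∑ i ∈ Finset.range p, b n i * ξ i ω) ⁻¹' {r | |r| ≤ M + 1}) := by
      refine mul_le_mul_of_nonneg_left (le_trans ?_ hR) (by positivity)
      rw [hprod]
      exact mul_le_mul_of_nonneg_left hcheb measureReal_nonneg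
    _ ≤ _ := key
    _ = _ := by
      congr 2
      ext ω
      simp only [mem_ofPred_eq, sum_range_split (b n) ω (show p + L = n - 1 by omega)]

end Steering

/-! ### Elementary bounds for the coefficients of the walk. -/

section Weights

/-- The increment over `[m, m + 1]` of the Volterra integral with lower limit `x`. -/
noncomputable def volterraIncr (a m x : ℝ) : ℝ :=
  ∫ v in (0 : ℝ)..1, (v + m) ^ a * (v + m - x) ^ (a - 1)

lemma intervalIntegrable_shift_rpow {a : ℝ} (ha : 0 < a) (c u w : ℝ) :
    IntervalIntegrable (fun v : ℝ => (v + c) ^ (a - 1)) volume u w := by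
  have := (intervalIntegral.intervalIntegrable_rpow' (a := u + c) (b := w + c)
    (by linarith : -1 < a - 1)).comp_add_right c
  simpa using this

lemma integral_shift_rpow {a : ℝ} (ha : 0 < a) (c : ℝ) :
    ∫ v in (0 : ℝ)..1, (v + c) ^ (a - 1) = ((1 + c) ^ a - c ^ a) / a := by
  rw [intervalIntegral.integral_comp_add_right (fun v => v ^ (a - 1)),
    integral_rpow (Or.inl (by linarith))]
  simp

variable {a m x : ℝ}

lemma intervalIntegrable_volterra (ha : 0 < a) (m x u w : ℝ) :
    IntervalIntegrable (fun v : ℝ => (v + m) ^ a * (v + m - x) ^ (a - 1)) volume u w := by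
  have h := intervalIntegrable_shift_rpow ha (m - x) u w
  simp only [← add_sub_assoc] at h
  refine h.continuousOn_mul (Continuous.continuousOn ?_)
  exact (continuous_id.add continuous_const).rpow_const fun _ => Or.inr ha.le

lemma volterraIncr_nonneg (hx0 : 0 ≤ x) (hx : x ≤ m) : 0 ≤ volterraIncr a m x := by
  refine intervalIntegral.integral_nonneg zero_le_one fun v hv => ?_
  have := hv.1
  exact mul_nonneg (Real.rpow_nonneg (by linarith) _) (Real.rpow_nonneg (by linarith) _)

/-- Only the regular factor is frozen at its maximum, while the singular one is integrated exactly.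
The bound therefore remains finite at `x = m`, as the weight `i = n - 1` requires. -/
lemma volterraIncr_le_mul_sub (ha : 0 < a) (hx0 : 0 ≤ x) (hx : x ≤ m) :
    volterraIncr a m x ≤ (m + 1) ^ a * (((m + 1 - x) ^ a - (m - x) ^ a) / a) := by
  have h := intervalIntegrable_shift_rpow ha (m - x) 0 1
  have hi := integral_shift_rpow ha (m - x)
  rw [show m + 1 - x = 1 + (m - x) by ring, ← hi, ← intervalIntegral.integral_const_mul]
  refine intervalIntegral.integral_mono_on zero_le_one (intervalIntegrable_volterra ha m x 0 1)
    (h.const_mul _) fun v hv => ?_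
  have h0 := hv.1
  have h1 := hv.2
  rw [add_sub_assoc]
  refine mul_le_mul_of_nonneg_right ?_ (Real.rpow_nonneg (by linarith) _)
  exact Real.rpow_le_rpow (by linarith) (by linarith) ha.le

/-- Both factors are replaced by their maxima over `v ∈ [0, 1]`, attained at opposite ends since `a
- 1 < 0`. -/
lemma volterraIncr_le (ha : 0 < a) (ha1 : a < 1) (hx0 : 0 ≤ x) (hx : x < m) :
    volterraIncr a m x ≤ (m + 1) ^ a * (m - x) ^ (a - 1) := by
  have : (m + 1) ^ a * (m - x) ^ (a - 1) =
      ∫ _ in (0 : ℝ)..1, (m + 1) ^ a * (m - x) ^ (a - 1) := by simp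
  rw [this]
  refine intervalIntegral.integral_mono_on zero_le_one (intervalIntegrable_volterra ha m x 0 1)
    intervalIntegrable_const fun v hv => ?_
  have h0 := hv.1
  have h1 := hv.2
  refine mul_le_mul ?_ ?_ (Real.rpow_nonneg (by linarith) _) (Real.rpow_nonneg (by linarith) _)
  · exact Real.rpow_le_rpow (by linarith) (by linarith) ha.le
  · exact Real.rpow_le_rpow_of_nonpos (by linarith) (by linarith) (by linarith)

lemma le_volterraIncr (ha : 0 < a) (ha1 : a < 1) (hx0 : 0 ≤ x) (hx : x ≤ m) :
    m ^ a * (m + 1 - x) ^ (a - 1) ≤ volterraIncr a m x := by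
  have : m ^ a * (m + 1 - x) ^ (a - 1) = ∫ _ in (0 : ℝ)..1, m ^ a * (m + 1 - x) ^ (a - 1) := by simp
  rw [this]
  -- The endpoint `v = 0` has to be left out: for `x = m` the singular factor is `0 ^ (a - 1)`,
  -- whose conventional value `0` violates the pointwise bound.
  refine intervalIntegral.integral_mono_on_of_le_Ioo zero_le_one intervalIntegrable_const
    (intervalIntegrable_volterra ha m x 0 1) fun v hv => ?_
  have h0 := hv.1
  have h1 := hv.2
  refine mul_le_mul ?_ ?_ (Real.rpow_nonneg (by linarith) _) (Real.rpow_nonneg (by linarith) _)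
  · exact Real.rpow_le_rpow (by linarith) (by linarith) ha.le
  · exact Real.rpow_le_rpow_of_nonpos (by linarith) (by linarith) (by linarith)

lemma measurable_volterraIncr (a m : ℝ) : Measurable (volterraIncr a m) := by
  have : StronglyMeasurable (Function.uncurry fun x v : ℝ => (v + m) ^ a * (v + m - x) ^ (a - 1)) :=
    Measurable.stronglyMeasurable (by unfold Function.uncurry; fun_prop)
  have h := (this.integral_prod_right (ν := volume.restrict (Ioc (0 : ℝ) 1))).measurable
  unfold volterraIncr
  simp_rw [intervalIntegral.integral_of_le (zero_le_one (α := ℝ))]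
  exact h

/-- The coefficient of the `i`-th sign at level `n`, up to the normalizing constant. -/
noncomputable def walkWeight (a : ℝ) (n i : ℕ) : ℝ :=
  ∫ x in ((i : ℝ) - 1)..(i : ℝ), x ^ (-a) * volterraIncr a ((n : ℝ) - 1) x

/-- The increment is bounded on `0 ≤ x ≤ m`, and the singularity `x ^ (-a)` at zero is integrable.
-/
lemma intervalIntegrable_weight (ha : 0 < a) (ha1 : a < 1) {u w : ℝ} (hu : 0 ≤ u) (huw : u ≤ w)
    (hw : w ≤ m) :
    IntervalIntegrable (fun x => x ^ (-a) * volterraIncr a m x) volume u w := by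
  have h := (intervalIntegral.intervalIntegrable_rpow' (a := u) (b := w)
    (by linarith : -1 < -a)).mul_const ((m + 1) ^ a * ((m + 1) ^ a / a))
  refine h.mono_fun ((Measurable.pow_const measurable_id _).mul
    (measurable_volterraIncr a m)).aestronglyMeasurable ?_
  refine (ae_restrict_iff' measurableSet_uIoc).2 (Eventually.of_forall fun x hx => ?_)
  rw [uIoc_of_le huw] at hx
  have hx0 : 0 ≤ x := hu.trans hx.1.le
  have hxm : x ≤ m := hx.2.trans hw
  simp only [norm_mul]
  refine mul_le_mul_of_nonneg_left ?_ (norm_nonneg _)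
  rw [Real.norm_of_nonneg (volterraIncr_nonneg hx0 hxm), ← norm_mul, Real.norm_of_nonneg
    (by have : (0:ℝ) ≤ m + 1 := by linarith
        positivity)]
  refine (volterraIncr_le_mul_sub ha hx0 hxm).trans ?_
  have h1 : (m + 1 - x) ^ a ≤ (m + 1) ^ a := Real.rpow_le_rpow (by linarith) (by linarith) ha.le
  have h2 : 0 ≤ (m - x) ^ a := Real.rpow_nonneg (by linarith) _
  refine mul_le_mul_of_nonneg_left ?_ (Real.rpow_nonneg (by linarith) _)
  gcongr
  linarith

lemma walkWeight_nonneg (a : ℝ) {n i : ℕ} (hi : 1 ≤ i) (hin : i < n) : 0 ≤ walkWeight a n i := by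
  have hi' : (1 : ℝ) ≤ i := by exact_mod_cast hi
  have hin' : (i : ℝ) + 1 ≤ n := by exact_mod_cast hin
  refine intervalIntegral.integral_nonneg (by linarith) fun x hx => ?_
  have h0 := hx.1
  have h1 := hx.2
  exact mul_nonneg (Real.rpow_nonneg (by linarith) _)
    (volterraIncr_nonneg (by linarith) (by linarith))

lemma le_walkWeight (ha : 0 < a) (ha1 : a < 1) {n i : ℕ} (hi : 1 ≤ i) (hin : i < n) :
    ((n : ℝ) - i + 1) ^ (a - 1) ≤ walkWeight a n i := by
  have hi' : (1 : ℝ) ≤ i := by exact_mod_cast hi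
  have hin' : (i : ℝ) + 1 ≤ n := by exact_mod_cast hin
  have : ((n : ℝ) - i + 1) ^ (a - 1) =
      ∫ _ in ((i : ℝ) - 1)..(i : ℝ), ((n : ℝ) - i + 1) ^ (a - 1) := by simp
  rw [this]
  -- The open interval excludes `x = 0`, which occurs for `i = 1` and where `x ^ (-a)` takes the
  -- conventional value `0`.
  refine intervalIntegral.integral_mono_on_of_le_Ioo (by linarith) intervalIntegrable_const
    (intervalIntegrable_weight ha ha1 (by linarith) (by linarith) (by linarith)) fun x hx => ?_
  have h0 := hx.1
  have h1 := hx.2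
  have hx0 : 0 < x := by linarith
  have hle := le_volterraIncr (m := (n : ℝ) - 1) ha ha1 hx0.le (by linarith)
  have hpow : (n : ℝ) - 1 + 1 - x = n - x := by ring
  rw [hpow] at hle
  have h2 : ((n : ℝ) - i + 1) ^ (a - 1) ≤ (n - x) ^ (a - 1) :=
    Real.rpow_le_rpow_of_nonpos (by linarith) (by linarith) (by linarith)
  have h3 : 1 ≤ x ^ (-a) * ((n : ℝ) - 1) ^ a := by
    have hxx : x ^ (-a) * x ^ a = 1 := by rw [← Real.rpow_add hx0]; simp
    rw [← hxx]
    gcongr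
    linarith
  have h4 : 0 ≤ ((n : ℝ) - x) ^ (a - 1) := Real.rpow_nonneg (by linarith) _
  calc ((n : ℝ) - i + 1) ^ (a - 1) ≤ 1 * (n - x) ^ (a - 1) := by linarith
    _ ≤ x ^ (-a) * ((n : ℝ) - 1) ^ a * (n - x) ^ (a - 1) := by gcongr
    _ = x ^ (-a) * (((n : ℝ) - 1) ^ a * (n - x) ^ (a - 1)) := by ring
    _ ≤ _ := by gcongr

/-- The integral is `(i^(1-a) - (i-1)^(1-a)) / (1-a)`. Its numerator is at most `i^(-a)` because
`(i-1)^(1-a) ≥ (i-1) i^(-a)`, and `1 - a ≥ 1/2`. -/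
lemma integral_rpow_neg_le (ha : 0 < a) (ha1 : a ≤ 1 / 2) {i : ℕ} (hi : 1 ≤ i) :
    ∫ x in ((i : ℝ) - 1)..(i : ℝ), x ^ (-a) ≤ 2 * (i : ℝ) ^ (-a) := by
  have hi' : (1 : ℝ) ≤ i := by exact_mod_cast hi
  rw [integral_rpow (Or.inl (by linarith)), div_le_iff₀ (by linarith)]
  have h1 : (i : ℝ) ^ (-a + 1) = (i : ℝ) ^ (-a) * i := by
    rw [Real.rpow_add (by linarith), Real.rpow_one]
  have h2 : ((i : ℝ) - 1) * (i : ℝ) ^ (-a) ≤ ((i : ℝ) - 1) ^ (-a + 1) := by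
    rcases eq_or_lt_of_le hi' with h | h
    · rw [← h]; simp; exact Real.rpow_nonneg le_rfl _
    · rw [Real.rpow_add (by linarith), Real.rpow_one, mul_comm]
      refine mul_le_mul_of_nonneg_right ?_ (by linarith)
      exact Real.rpow_le_rpow_of_nonpos (by linarith) (by linarith) (by linarith)
  have h3 : 0 ≤ (i : ℝ) ^ (-a) := Real.rpow_nonneg (by linarith) _
  rw [h1]
  nlinarith

/-- Upper bound for the weights, away from the last one. -/
lemma walkWeight_le (ha : 0 < a) (ha1 : a ≤ 1 / 2) {n i : ℕ} (hi : 1 ≤ i) (hin : i + 1 < n) :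
    walkWeight a n i ≤ 4 * ((n : ℝ) ^ a * (i : ℝ) ^ (-a) * ((n : ℝ) - i) ^ (a - 1)) := by
  have hi' : (1 : ℝ) ≤ i := by exact_mod_cast hi
  have hin' : (i : ℝ) + 2 ≤ n := by exact_mod_cast hin
  have hn : (0 : ℝ) ≤ n := by positivity
  have hstep : walkWeight a n i ≤
      ∫ x in ((i : ℝ) - 1)..(i : ℝ), x ^ (-a) * ((n : ℝ) ^ a * ((n : ℝ) - 1 - i) ^ (a - 1)) := by
    refine intervalIntegral.integral_mono_on (by linarith)
      (intervalIntegrable_weight ha (by linarith) (by linarith) (by linarith) (by linarith))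
      ((intervalIntegral.intervalIntegrable_rpow' (by linarith)).mul_const _) fun x hx => ?_
    have h0 := hx.1
    have h1 := hx.2
    refine mul_le_mul_of_nonneg_left ?_ (Real.rpow_nonneg (by linarith) _)
    refine (volterraIncr_le ha (by linarith) (by linarith) (by linarith)).trans ?_
    rw [sub_add_cancel]
    refine mul_le_mul_of_nonneg_left ?_ (Real.rpow_nonneg hn _)
    exact Real.rpow_le_rpow_of_nonpos (by linarith) (by linarith) (by linarith)
  rw [intervalIntegral.integral_mul_const] at hstep
  have hint := integral_rpow_neg_le ha ha1 hi
  -- Since `n - i ≥ 2`, removing `1` at most halves the distance. This is where the last weight is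
  -- excluded.
  have hhalf : ((n : ℝ) - 1 - i) ^ (a - 1) ≤ 2 * ((n : ℝ) - i) ^ (a - 1) := by
    have h1 : ((n : ℝ) - 1 - i) ^ (a - 1) ≤ (((n : ℝ) - i) / 2) ^ (a - 1) :=
      Real.rpow_le_rpow_of_nonpos (by linarith) (by linarith) (by linarith)
    refine h1.trans ?_
    rw [Real.div_rpow (by linarith) (by norm_num), div_eq_mul_inv, mul_comm,
      ← Real.rpow_neg (by norm_num)]
    refine mul_le_mul_of_nonneg_right ?_ (Real.rpow_nonneg (by linarith) _)
    calc (2 : ℝ) ^ (-(a - 1)) ≤ 2 ^ (1 : ℝ) :=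
          Real.rpow_le_rpow_of_exponent_le (by norm_num) (by linarith)
      _ = 2 := by simp
  have p1 : 0 ≤ (n : ℝ) ^ a := Real.rpow_nonneg hn _
  have p2 : 0 ≤ ((n : ℝ) - 1 - i) ^ (a - 1) := Real.rpow_nonneg (by linarith) _
  have p3 : 0 ≤ (i : ℝ) ^ (-a) := Real.rpow_nonneg (by linarith) _
  calc walkWeight a n i ≤ _ := hstep
    _ ≤ 2 * (i : ℝ) ^ (-a) * ((n : ℝ) ^ a * (2 * ((n : ℝ) - i) ^ (a - 1))) := by gcongr
    _ = _ := by ring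

/-! ### Two-sided bounds for the barrier. -/

/-- The coefficient of the last step at level `n`, up to the normalizing constant. -/
noncomputable def stepWeight (a : ℝ) (n : ℕ) : ℝ :=
  ∫ x in ((n : ℝ) - 1)..(n : ℝ), x ^ (-a) * ((n : ℝ) - x) ^ a *
    ∫ y in (0 : ℝ)..1, (y * (n - x) + x) ^ a * y ^ (a - 1)

lemma intervalIntegrable_stepInner (ha : 0 < a) (c x : ℝ) :
    IntervalIntegrable (fun y : ℝ => (y * (c - x) + x) ^ a * y ^ (a - 1)) volume 0 1 := by
  refine (intervalIntegral.intervalIntegrable_rpow' (by linarith)).continuousOn_mul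
    (Continuous.continuousOn ?_)
  exact ((continuous_id.mul continuous_const).add continuous_const).rpow_const fun _ => Or.inr ha.le

lemma integral_rpow_sub_one (ha : 0 < a) : ∫ y in (0 : ℝ)..1, y ^ (a - 1) = 1 / a := by
  rw [integral_rpow (Or.inl (by linarith))]
  simp [ha.ne']

lemma le_stepInner (ha : 0 < a) {c : ℝ} (hx : 0 ≤ x) (hxc : x ≤ c) :
    x ^ a * (1 / a) ≤ ∫ y in (0 : ℝ)..1, (y * (c - x) + x) ^ a * y ^ (a - 1) := by
  rw [← integral_rpow_sub_one ha, ← intervalIntegral.integral_const_mul]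
  refine intervalIntegral.integral_mono_on zero_le_one
    ((intervalIntegral.intervalIntegrable_rpow' (by linarith)).const_mul _)
    (intervalIntegrable_stepInner ha c x) fun y hy => ?_
  have : 0 ≤ y * (c - x) := mul_nonneg hy.1 (by linarith)
  refine mul_le_mul_of_nonneg_right ?_ (Real.rpow_nonneg hy.1 _)
  exact Real.rpow_le_rpow hx (by linarith) ha.le

lemma stepInner_le (ha : 0 < a) {c : ℝ} (hx : 0 ≤ x) (hxc : x ≤ c) :
    ∫ y in (0 : ℝ)..1, (y * (c - x) + x) ^ a * y ^ (a - 1) ≤ c ^ a * (1 / a) := by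
  rw [← integral_rpow_sub_one ha, ← intervalIntegral.integral_const_mul]
  refine intervalIntegral.integral_mono_on zero_le_one
    (intervalIntegrable_stepInner ha c x)
    ((intervalIntegral.intervalIntegrable_rpow' (by linarith)).const_mul _) fun y hy => ?_
  have h1 : 0 ≤ y * (c - x) := mul_nonneg hy.1 (by linarith)
  have h2 : y * (c - x) ≤ c - x := mul_le_of_le_one_left (by linarith) hy.2
  refine mul_le_mul_of_nonneg_right ?_ (Real.rpow_nonneg hy.1 _)
  exact Real.rpow_le_rpow (by linarith) (by linarith) ha.le

lemma measurable_stepInner (a c : ℝ) :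
    Measurable fun x : ℝ => ∫ y in (0 : ℝ)..1, (y * (c - x) + x) ^ a * y ^ (a - 1) := by
  have : StronglyMeasurable
      (Function.uncurry fun x y : ℝ => (y * (c - x) + x) ^ a * y ^ (a - 1)) :=
    Measurable.stronglyMeasurable (by unfold Function.uncurry; fun_prop)
  have h := (this.integral_prod_right (ν := volume.restrict (Ioc (0 : ℝ) 1))).measurable
  simp_rw [intervalIntegral.integral_of_le (zero_le_one (α := ℝ))]
  exact h

lemma stepIntegrand_bounds (ha : 0 < a) (ha1 : a ≤ 1) {n : ℕ} (hn : 2 ≤ n)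
    (hx : x ∈ Icc ((n : ℝ) - 1) n) :
    1 / a * ((n : ℝ) - x) ^ a ≤ x ^ (-a) * ((n : ℝ) - x) ^ a *
        (∫ y in (0 : ℝ)..1, (y * (n - x) + x) ^ a * y ^ (a - 1)) ∧
      x ^ (-a) * ((n : ℝ) - x) ^ a *
        (∫ y in (0 : ℝ)..1, (y * (n - x) + x) ^ a * y ^ (a - 1)) ≤ 2 / a := by
  have hn' : (2 : ℝ) ≤ n := by exact_mod_cast hn
  have h0 := hx.1
  have h1 := hx.2
  have hx0 : 0 < x := by linarith
  have hxx : x ^ (-a) * x ^ a = 1 := by rw [← Real.rpow_add hx0]; simp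
  have p1 : 0 ≤ x ^ (-a) := Real.rpow_nonneg hx0.le _
  have p2 : 0 ≤ ((n : ℝ) - x) ^ a := Real.rpow_nonneg (by linarith) _
  have p3 : ((n : ℝ) - x) ^ a ≤ 1 := Real.rpow_le_one (by linarith) (by linarith) ha.le
  constructor
  · calc 1 / a * ((n : ℝ) - x) ^ a = (x ^ (-a) * x ^ a) * ((n : ℝ) - x) ^ a * (1 / a) := by
          rw [hxx]; ring
      _ = x ^ (-a) * ((n : ℝ) - x) ^ a * (x ^ a * (1 / a)) := by ring
      _ ≤ _ := by gcongr; exact le_stepInner ha hx0.le h1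
  -- For `n ≥ 2` one has `x ≥ n - 1 ≥ n / 2`. For `n = 1` the interval would reach down to `x = 0`.
  · have hratio : x ^ (-a) * (n : ℝ) ^ a ≤ 2 := by
      have h2 : (n : ℝ) ^ a ≤ (2 * x) ^ a := Real.rpow_le_rpow (by linarith) (by linarith) ha.le
      rw [Real.mul_rpow (by norm_num) hx0.le] at h2
      have h3 : (2 : ℝ) ^ a ≤ 2 := by
        calc (2 : ℝ) ^ a ≤ 2 ^ (1 : ℝ) := Real.rpow_le_rpow_of_exponent_le (by norm_num) ha1
          _ = 2 := by simp
      calc x ^ (-a) * (n : ℝ) ^ a ≤ x ^ (-a) * (2 ^ a * x ^ a) := by gcongr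
        _ = 2 ^ a * (x ^ (-a) * x ^ a) := by ring
        _ ≤ 2 := by rw [hxx]; linarith
    have p4 : 0 ≤ x ^ (-a) * (n : ℝ) ^ a := by positivity
    calc _ ≤ x ^ (-a) * ((n : ℝ) - x) ^ a * ((n : ℝ) ^ a * (1 / a)) := by
          gcongr; exact stepInner_le ha hx0.le h1
      _ = (x ^ (-a) * (n : ℝ) ^ a) * ((n : ℝ) - x) ^ a * (1 / a) := by ring
      _ ≤ 2 * 1 * (1 / a) := by gcongr
      _ = 2 / a := by ring

lemma stepWeight_le (ha : 0 < a) (ha1 : a ≤ 1) {n : ℕ} (hn : 2 ≤ n) : stepWeight a n ≤ 2 / a := by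
  have := intervalIntegral.norm_integral_le_of_norm_le_const (a := (n : ℝ) - 1) (b := n)
    (C := 2 / a) (f := fun x => x ^ (-a) * ((n : ℝ) - x) ^ a *
    ∫ y in (0 : ℝ)..1, (y * (n - x) + x) ^ a * y ^ (a - 1)) (fun x hx => by
      rw [uIoc_of_le (by linarith)] at hx
      have hb := stepIntegrand_bounds ha ha1 hn ⟨hx.1.le, hx.2⟩
      rw [Real.norm_of_nonneg]
      · exact hb.2
      · refine le_trans ?_ hb.1
        have := hx.2
        exact mul_nonneg (by positivity) (Real.rpow_nonneg (by linarith) _))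
  refine (le_abs_self _).trans (this.trans ?_)
  simp

/-- The constant is the integral of the lower bound `(n - x)^a / a` over the unit interval. -/
lemma le_stepWeight (ha : 0 < a) (ha1 : a ≤ 1) {n : ℕ} (hn : 2 ≤ n) :
    1 / (a * (a + 1)) ≤ stepWeight a n := by
  have hint : ∫ x in ((n : ℝ) - 1)..(n : ℝ), 1 / a * ((n : ℝ) - x) ^ a = 1 / (a * (a + 1)) := by
    rw [intervalIntegral.integral_const_mul,
      intervalIntegral.integral_comp_sub_left (fun x => x ^ a),
      integral_rpow (Or.inl (by linarith))]
    have : (0 : ℝ) ^ (a + 1) = 0 := Real.zero_rpow (by linarith)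
    simp [this]
    field_simp
  rw [← hint]
  have hcont : Continuous fun x : ℝ => 1 / a * ((n : ℝ) - x) ^ a :=
    continuous_const.mul ((continuous_const.sub continuous_id).rpow_const fun _ => Or.inr ha.le)
  refine intervalIntegral.integral_mono_on (by linarith) (hcont.intervalIntegrable _ _) ?_
    fun x hx => (stepIntegrand_bounds ha ha1 hn hx).1
  refine (intervalIntegrable_const (c := 2 / a)).mono_fun ?_ ?_
  · exact (((Measurable.pow_const measurable_id _).mul
      ((measurable_const.sub measurable_id).pow_const _)).mul
      (measurable_stepInner a n)).aestronglyMeasurable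
  · refine (ae_restrict_iff' measurableSet_uIoc).2 (Eventually.of_forall fun x hx => ?_)
    rw [uIoc_of_le (by linarith)] at hx
    have hb := stepIntegrand_bounds ha ha1 hn ⟨hx.1.le, hx.2⟩
    have := hx.2
    have h0 : 0 ≤ 1 / a * ((n : ℝ) - x) ^ a :=
      mul_nonneg (by positivity) (Real.rpow_nonneg (by linarith) _)
    beta_reduce
    rw [Real.norm_of_nonneg (h0.trans hb.1), Real.norm_of_nonneg (by positivity)]
    exact hb.2

end Weights

/-! ### Uniform and asymptotic behaviour of the weights. -/

section WeightAsymptotics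

variable {a : ℝ}

/-- The last `L` weights add up to an arbitrarily large amount. -/
lemma exists_le_sum_last_weights (ha : 0 < a) (ha1 : a < 1) (C : ℝ) :
    ∃ L : ℕ, 1 ≤ L ∧ ∀ n ≥ L + 2,
      C ≤ ∑ l : Fin L, walkWeight a n (n - 1 - L + (l : ℕ) + 1) := by
  -- Each of the last `L` weights is at least `(L + 1)^(a - 1)`, and `L ≥ (L + 1) / 2`, so their sum
  -- is at least `L^a / 2`.
  have htend : Tendsto (fun L : ℕ => (1 / 2 : ℝ) * (L : ℝ) ^ a) atTop atTop :=
    ((tendsto_rpow_atTop ha).comp tendsto_natCast_atTop_atTop).const_mul_atTop (by norm_num)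
  obtain ⟨L, hC, hL⟩ := ((htend.eventually_ge_atTop C).and (eventually_ge_atTop 1)).exists
  refine ⟨L, hL, fun n hn => hC.trans ?_⟩
  have hL' : (1 : ℝ) ≤ L := by exact_mod_cast hL
  have hterm : ∀ l : Fin L, ((L : ℝ) + 1) ^ (a - 1) ≤
      walkWeight a n (n - 1 - L + (l : ℕ) + 1) := by
    intro l
    have hl := l.2
    refine le_trans ?_ (le_walkWeight ha ha1 (by omega) (by omega))
    have hcast : ((n - 1 - L + (l : ℕ) + 1 : ℕ) : ℝ) = (n : ℝ) - L + (l : ℕ) := by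
      rw [eq_comm, sub_add_eq_add_sub, sub_eq_iff_eq_add]
      norm_cast
      omega
    rw [hcast]
    have h0 : (0 : ℝ) ≤ (l : ℕ) := by positivity
    have h1 : ((l : ℕ) : ℝ) + 1 ≤ L := by exact_mod_cast hl
    exact Real.rpow_le_rpow_of_nonpos (by linarith) (by linarith) (by linarith)
  calc 1 / 2 * (L : ℝ) ^ a ≤ 1 / 2 * ((L : ℝ) + 1) ^ a := by gcongr; linarith
    _ = 1 / 2 * (((L : ℝ) + 1) * ((L : ℝ) + 1) ^ (a - 1)) := by
        rw [Real.rpow_sub_one (by linarith)]; field_simp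
    _ ≤ L * ((L : ℝ) + 1) ^ (a - 1) := by
        have : 0 ≤ ((L : ℝ) + 1) ^ (a - 1) := by positivity
        nlinarith
    _ = ∑ _l : Fin L, ((L : ℝ) + 1) ^ (a - 1) := by simp
    _ ≤ _ := Finset.sum_le_sum fun l _ => hterm l

/-- The value `7/8` is chosen to cancel the factor `8/7` lost in comparing `x` with `n` in
`last_weights_le`; indeed `2^(3/2) - 2 < 0.83`. -/
lemma two_rpow_bound (ha1 : a ≤ 1 / 2) : (2 : ℝ) ^ (a + 1) - 2 ≤ 7 / 8 := by
  have h : (2 : ℝ) ^ (a + 1) ≤ 2 ^ (3 / 2 : ℝ) :=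
    Real.rpow_le_rpow_of_exponent_le (by norm_num) (by linarith)
  have h2 : ((2 : ℝ) ^ (3 / 2 : ℝ)) ^ 2 = 8 := by
    rw [← Real.rpow_natCast, ← Real.rpow_mul (by norm_num)]; norm_num
  nlinarith [Real.rpow_nonneg (show (0:ℝ) ≤ 2 by norm_num) (3 / 2 : ℝ)]

lemma rpow_neg_mul_rpow_le (ha : 0 < a) (ha1 : a ≤ 1) {x c q : ℝ} (hx : 0 < x) (hq : 1 ≤ q)
    (hc0 : 0 ≤ c) (hc : c ≤ q * x) : x ^ (-a) * c ^ a ≤ q := by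
  have hxx : x ^ (-a) * x ^ a = 1 := by rw [← Real.rpow_add hx]; simp
  have h1 : c ^ a ≤ q ^ a * x ^ a := by
    rw [← Real.mul_rpow (by linarith) hx.le]
    exact Real.rpow_le_rpow hc0 hc ha.le
  have h2 : q ^ a ≤ q := by
    calc q ^ a ≤ q ^ (1 : ℝ) := Real.rpow_le_rpow_of_exponent_le hq ha1
      _ = q := by simp
  have p : 0 ≤ x ^ (-a) := Real.rpow_nonneg hx.le _
  calc x ^ (-a) * c ^ a ≤ x ^ (-a) * (q ^ a * x ^ a) := by gcongr
    _ = q ^ a * (x ^ (-a) * x ^ a) := by ring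
    _ ≤ q := by rw [hxx]; linarith

lemma integral_rpow_diff (ha : 0 < a) (n : ℝ) :
    ∫ x in (n - 2)..(n - 1), ((n - x) ^ a - (n - 1 - x) ^ a) / a =
      (2 ^ (a + 1) - 2) / (a * (a + 1)) := by
  have hc : ∀ c : ℝ, Continuous fun x : ℝ => (c - x) ^ a := fun c =>
    (continuous_const.sub continuous_id).rpow_const fun _ => Or.inr ha.le
  have h0 : (0 : ℝ) ^ (a + 1) = 0 := Real.zero_rpow (by linarith)
  rw [intervalIntegral.integral_div, intervalIntegral.integral_sub
    ((hc n).intervalIntegrable _ _) ((hc (n - 1)).intervalIntegrable _ _),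
    intervalIntegral.integral_comp_sub_left (fun x => x ^ a),
    intervalIntegral.integral_comp_sub_left (fun x => x ^ a),
    integral_rpow (Or.inl (by linarith)), integral_rpow (Or.inl (by linarith))]
  have e1 : n - (n - 1) = 1 := by ring
  have e2 : n - (n - 2) = 2 := by ring
  have e3 : n - 1 - (n - 2) = 1 := by ring
  rw [e1, e2, e3, sub_self, h0, Real.one_rpow]
  field_simp
  ring

/-- Eventually, none of the last `L` weights exceeds the lower bound for the step weight. -/
lemma last_weights_le (ha : 0 < a) (ha1 : a ≤ 1 / 2) {L n : ℕ} (hn : 8 * (L + 1) ≤ n)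
    {l : ℕ} (hl : l < L) : walkWeight a n (n - 1 - L + l + 1) ≤ 1 / (a * (a + 1)) := by
  obtain ⟨i, hi⟩ : ∃ i, i = n - 1 - L + l + 1 := ⟨_, rfl⟩
  rw [← hi]
  have hn' : 8 * ((L : ℝ) + 1) ≤ n := by exact_mod_cast hn
  have hL0 : (0 : ℝ) ≤ L := by positivity
  have hi1 : (n : ℝ) ≤ (i : ℝ) + L := by norm_cast; omega
  -- Here `x ≥ i - 1 ≥ n - (L + 1) ≥ 7n/8`.
  have hratio : ∀ x : ℝ, (i : ℝ) - 1 ≤ x → x ^ (-a) * (n : ℝ) ^ a ≤ 8 / 7 := fun x hx =>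
    rpow_neg_mul_rpow_le ha (by linarith) (by linarith) (by norm_num) (by positivity) (by linarith)
  have hden : 0 < a * (a + 1) := by positivity
  -- For `i ≤ n - 2` the singular factor is at most `1`, and `8/7 ≤ 1/(a(a+1))` because `a(a+1) ≤
  -- 3/4`. For `i = n - 1` the singularity touches the interval, and the exactly integrated bound
  -- gives `8/7 · (2^(a+1) - 2)/(a(a+1))`.
  rcases Nat.lt_or_ge (i + 1) n with hin | hin
  · have hin' : (i : ℝ) + 2 ≤ n := by exact_mod_cast hin
    have hb : ∀ x ∈ Set.uIoc ((i : ℝ) - 1) i,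
        ‖x ^ (-a) * volterraIncr a ((n : ℝ) - 1) x‖ ≤ 8 / 7 := by
      intro x hx
      rw [uIoc_of_le (by linarith)] at hx
      have h0 := hx.1
      have h1 := hx.2
      have hv := volterraIncr_le ha (by linarith) (m := (n : ℝ) - 1) (x := x) (by linarith)
        (by linarith)
      have hone : ((n : ℝ) - 1 - x) ^ (a - 1) ≤ 1 :=
        Real.rpow_le_one_of_one_le_of_nonpos (by linarith) (by linarith)
      have p1 : 0 ≤ x ^ (-a) := Real.rpow_nonneg (by linarith) _
      have p2 := volterraIncr_nonneg (a := a) (m := (n : ℝ) - 1) (x := x) (by linarith)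
        (by linarith)
      rw [Real.norm_of_nonneg (mul_nonneg p1 p2)]
      rw [sub_add_cancel] at hv
      calc x ^ (-a) * volterraIncr a ((n : ℝ) - 1) x ≤ x ^ (-a) * ((n : ℝ) ^ a * 1) := by
            refine mul_le_mul_of_nonneg_left (hv.trans ?_) p1
            exact mul_le_mul_of_nonneg_left hone (by positivity)
        _ ≤ 8 / 7 := by rw [mul_one]; exact hratio x h0.le
    have := intervalIntegral.norm_integral_le_of_norm_le_const hb
    refine (le_abs_self _).trans (this.trans ?_)
    rw [sub_sub_cancel, abs_one, mul_one, le_div_iff₀ hden]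
    nlinarith
  · have hin' : (i : ℝ) = n - 1 := by
      rw [eq_sub_iff_add_eq]; norm_cast; omega
    have hcont : Continuous fun x : ℝ => (((n : ℝ) - x) ^ a - ((n : ℝ) - 1 - x) ^ a) / a := by
      have hc : ∀ c : ℝ, Continuous fun x : ℝ => (c - x) ^ a := fun c =>
        (continuous_const.sub continuous_id).rpow_const fun _ => Or.inr ha.le
      exact ((hc _).sub (hc _)).div_const a
    have hle : walkWeight a n i ≤ ∫ x in ((i : ℝ) - 1)..(i : ℝ),
        8 / 7 * ((((n : ℝ) - x) ^ a - ((n : ℝ) - 1 - x) ^ a) / a) := by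
      refine intervalIntegral.integral_mono_on (by linarith)
        (intervalIntegrable_weight ha (by linarith) (by linarith) (by linarith) (by linarith))
        ((continuous_const.mul hcont).intervalIntegrable _ _) fun x hx => ?_
      have h0 := hx.1
      have h1 := hx.2
      have hv := volterraIncr_le_mul_sub ha (m := (n : ℝ) - 1) (x := x) (by linarith) (by linarith)
      rw [sub_add_cancel] at hv
      have p1 : 0 ≤ x ^ (-a) := Real.rpow_nonneg (by linarith) _
      have p2 : 0 ≤ (((n : ℝ) - x) ^ a - ((n : ℝ) - 1 - x) ^ a) / a := by
        refine div_nonneg (sub_nonneg.2 ?_) ha.le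
        exact Real.rpow_le_rpow (by linarith) (by linarith) ha.le
      calc _ ≤ x ^ (-a) * ((n : ℝ) ^ a * ((((n : ℝ) - x) ^ a - ((n : ℝ) - 1 - x) ^ a) / a)) := by
            gcongr
        _ = (x ^ (-a) * (n : ℝ) ^ a) * ((((n : ℝ) - x) ^ a - ((n : ℝ) - 1 - x) ^ a) / a) := by ring
        _ ≤ _ := by gcongr; exact hratio x h0
    refine hle.trans ?_
    rw [intervalIntegral.integral_const_mul, hin', show (n : ℝ) - 1 - 1 = n - 2 by ring,
      integral_rpow_diff ha, ← mul_div_assoc]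
    gcongr
    linarith [two_rpow_bound ha1]

/-- Subadditivity, `n^a ≤ i^a + (n-i)^a`, eliminates the growing factor `n^a`. -/
lemma walkWeight_le_add (ha : 0 < a) (ha1 : a ≤ 1 / 2) {n i : ℕ} (hi : 1 ≤ i) (hin : i + 1 < n) :
    walkWeight a n i ≤
      4 * (((n : ℝ) - i) ^ (a - 1) + (i : ℝ) ^ (-a) * ((n : ℝ) - i) ^ (2 * a - 1)) := by
  refine (walkWeight_le ha ha1 hi hin).trans ?_
  have hi' : (0 : ℝ) < i := by exact_mod_cast hi
  have hd : (0 : ℝ) < (n : ℝ) - i := by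
    have : (i : ℝ) + 2 ≤ n := by exact_mod_cast hin
    linarith
  have hsub : (n : ℝ) ^ a ≤ (i : ℝ) ^ a + ((n : ℝ) - i) ^ a := by
    have := Real.rpow_add_le_add_rpow hi'.le hd.le ha.le (by linarith : a ≤ 1)
    simpa using this
  have hxx : (i : ℝ) ^ a * (i : ℝ) ^ (-a) = 1 := by rw [← Real.rpow_add hi']; simp
  have hdd : ((n : ℝ) - i) ^ a * ((n : ℝ) - i) ^ (a - 1) = ((n : ℝ) - i) ^ (2 * a - 1) := by
    rw [← Real.rpow_add hd]; ring_nf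
  have p1 : 0 ≤ (i : ℝ) ^ (-a) := by positivity
  have p2 : 0 ≤ ((n : ℝ) - i) ^ (a - 1) := Real.rpow_nonneg hd.le _
  gcongr
  calc (n : ℝ) ^ a * (i : ℝ) ^ (-a) * ((n : ℝ) - i) ^ (a - 1)
      ≤ ((i : ℝ) ^ a + ((n : ℝ) - i) ^ a) * (i : ℝ) ^ (-a) * ((n : ℝ) - i) ^ (a - 1) := by gcongr
    _ = ((i : ℝ) ^ a * (i : ℝ) ^ (-a)) * ((n : ℝ) - i) ^ (a - 1) +
        (i : ℝ) ^ (-a) * (((n : ℝ) - i) ^ a * ((n : ℝ) - i) ^ (a - 1)) := by ring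
    _ = _ := by rw [hxx, hdd, one_mul]

/-- Both powers decrease, so the product is at most its value with both bases equal to the smaller
one. -/
lemma rpow_mul_rpow_le_add {p q x y : ℝ} (hp : p ≤ 0) (hq : q ≤ 0) (hx : 0 < x) (hy : 0 < y) :
    x ^ p * y ^ q ≤ x ^ (p + q) + y ^ (p + q) := by
  rw [Real.rpow_add hx, Real.rpow_add hy]
  have := Real.rpow_pos_of_pos hx p
  have := Real.rpow_pos_of_pos hx q
  have := Real.rpow_pos_of_pos hy p
  have := Real.rpow_pos_of_pos hy q
  rcases le_total x y with h | h
  · have h1 : y ^ q ≤ x ^ q := Real.rpow_le_rpow_of_nonpos hx h hq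
    have : x ^ p * y ^ q ≤ x ^ p * x ^ q := by gcongr
    have : 0 < y ^ p * y ^ q := by positivity
    linarith
  · have h1 : x ^ p ≤ y ^ p := Real.rpow_le_rpow_of_nonpos hy h hp
    have : x ^ p * y ^ q ≤ y ^ p * y ^ q := by gcongr
    have : 0 < x ^ p * x ^ q := by positivity
    linarith

/-- The mixed term `i^(-a) (n-i)^(2a-1)` separates into pure powers with exponent `a - 1`, so that
the squares can be summed over `i` and over `n - i` independently. -/
lemma sq_walkWeight_le (ha : 0 < a) (ha1 : a ≤ 1 / 2) {n i : ℕ} (hi : 1 ≤ i) (hin : i + 1 < n) :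
    walkWeight a n i ^ 2 ≤
      128 * (((n - i : ℕ) : ℝ) ^ (2 * a - 2) + (i : ℝ) ^ (2 * a - 2)) := by
  have hi' : (0 : ℝ) < i := by exact_mod_cast hi
  have hcast : ((n - i : ℕ) : ℝ) = (n : ℝ) - i := Nat.cast_sub (by omega)
  have hd : (0 : ℝ) < (n : ℝ) - i := by
    have : (i : ℝ) + 2 ≤ n := by exact_mod_cast hin
    linarith
  rw [hcast]
  have h0 := walkWeight_nonneg a hi (by omega : i < n)
  have h1 := walkWeight_le_add ha ha1 hi hin
  have h2 := rpow_mul_rpow_le_add (p := -a) (q := 2 * a - 1) (by linarith) (by linarith) hi' hd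
  rw [show -a + (2 * a - 1) = a - 1 by ring] at h2
  have hsq : ∀ y : ℝ, 0 < y → y ^ (2 * a - 2) = (y ^ (a - 1)) ^ 2 := fun y hy => by
    rw [sq, ← Real.rpow_add hy]; ring_nf
  rw [hsq _ hd, hsq _ hi']
  set X := ((n : ℝ) - i) ^ (a - 1)
  set Y := (i : ℝ) ^ (a - 1)
  have h3 : walkWeight a n i ≤ 4 * (2 * X + Y) := by linarith
  calc walkWeight a n i ^ 2 ≤ (4 * (2 * X + Y)) ^ 2 := by gcongr
    _ ≤ 128 * (X ^ 2 + Y ^ 2) := by nlinarith [sq_nonneg (2 * X - Y), sq_nonneg (X - Y), sq_nonneg Y]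

/-- The squares of the weights, without the last one, have a bounded sum. -/
lemma sum_sq_walkWeight_le (ha : 0 < a) (ha1 : a < 1 / 2) :
    ∃ V : ℝ, ∀ n p : ℕ, p + 2 ≤ n →
      ∑ i ∈ Finset.range p, walkWeight a n (i + 1) ^ 2 ≤ V := by
  have hs : Summable fun k : ℕ => (k : ℝ) ^ (2 * a - 2) :=
    Real.summable_nat_rpow.2 (by linarith)
  have hnn : ∀ k : ℕ, 0 ≤ (k : ℝ) ^ (2 * a - 2) := fun k => by positivity
  set S := ∑' k : ℕ, (k : ℝ) ^ (2 * a - 2)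
  -- The indices `i + 1` and `n - (i + 1)` each run through distinct naturals, so one convergent
  -- series bounds both sums, uniformly in `n` and `p`.
  have hinj : ∀ (f : ℕ → ℕ) (p : ℕ), Set.InjOn f (Finset.range p) →
      ∑ i ∈ Finset.range p, ((f i : ℕ) : ℝ) ^ (2 * a - 2) ≤ S := by
    intro f p hf
    rw [← Finset.sum_image (f := fun k : ℕ => (k : ℝ) ^ (2 * a - 2)) hf]
    exact hs.sum_le_tsum _ fun k _ => hnn k
  refine ⟨128 * (S + S), fun n p hp => ?_⟩
  calc ∑ i ∈ Finset.range p, walkWeight a n (i + 1) ^ 2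
      ≤ ∑ i ∈ Finset.range p, 128 * (((n - (i + 1) : ℕ) : ℝ) ^ (2 * a - 2) +
          ((i + 1 : ℕ) : ℝ) ^ (2 * a - 2)) := by
        refine Finset.sum_le_sum fun i hi => ?_
        rw [Finset.mem_range] at hi
        exact sq_walkWeight_le ha ha1.le (by omega) (by omega)
    _ ≤ 128 * (S + S) := by
        rw [← Finset.mul_sum, Finset.sum_add_distrib]
        gcongr
        · refine hinj (fun i => n - (i + 1)) p fun i hi j hj hij => ?_
          simp only [Finset.coe_range, mem_Iio] at hi hj hij
          omega
        · exact hinj (fun i => i + 1) p fun i _ j _ hij => by simpa using hij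

/-- Each sign is forgotten in the long run. -/
lemma tendsto_walkWeight (ha : 0 < a) (ha1 : a < 1 / 2) {i : ℕ} (hi : 1 ≤ i) :
    Tendsto (fun n : ℕ => walkWeight a n i) atTop (𝓝 0) := by
  have hd : Tendsto (fun n : ℕ => (n : ℝ) - i) atTop atTop :=
    tendsto_atTop_add_const_right _ _ tendsto_natCast_atTop_atTop
  have hpow : ∀ s : ℝ, 0 < s → Tendsto (fun n : ℕ => ((n : ℝ) - i) ^ (-s)) atTop (𝓝 0) :=
    fun s hs => (tendsto_rpow_neg_atTop hs).comp hd
  have h1 := hpow (1 - a) (by linarith)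
  have h2 := hpow (1 - 2 * a) (by linarith)
  rw [neg_sub] at h1 h2
  have hlim := (h1.add (h2.const_mul ((i : ℝ) ^ (-a)))).const_mul 4
  simp only [mul_zero, add_zero] at hlim
  refine squeeze_zero' ?_ ?_ hlim
  · filter_upwards [eventually_ge_atTop (i + 2)] with n hn
    exact walkWeight_nonneg a hi (by omega)
  · filter_upwards [eventually_ge_atTop (i + 2)] with n hn
    exact walkWeight_le_add ha ha1.le hi (by omega)

end WeightAsymptotics

/-! ### Self-similarity: reduction of the `N`-period coefficients to the walk. -/

section Scaling

lemma cH_pos {H : ℝ} (hH : 1 / 2 < H) (hH1 : H < 1) : 0 < cH H := by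
  have h1 := Real.Gamma_pos_of_pos (show 0 < 3 / 2 - H by linarith)
  have h2 := Real.Gamma_pos_of_pos (show 0 < H + 1 / 2 by linarith)
  have h3 := Real.Gamma_pos_of_pos (show 0 < 2 - 2 * H by linarith)
  have h4 : 0 < 2 * H := by linarith
  exact Real.sqrt_pos.2 (by positivity)

lemma smallJ_eq (σ H : ℝ) (n i : ℕ) :
    smallJ σ H n i = σ * (cH H * (H - 1 / 2)) * walkWeight (H - 1 / 2) n i := by
  have e1 : (1 : ℝ) / 2 - H = -(H - 1 / 2) := by ring
  have e2 : H - 3 / 2 = H - 1 / 2 - 1 := by ring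
  simp only [smallJ, walkWeight, volterraIncr, e1, e2, add_sub_assoc]

lemma smallG_eq (σ H : ℝ) (n : ℕ) :
    smallG σ H n = σ * (cH H * (H - 1 / 2)) * stepWeight (H - 1 / 2) n := by
  have e1 : (1 : ℝ) / 2 - H = -(H - 1 / 2) := by ring
  have e2 : H - 3 / 2 = H - 1 / 2 - 1 := by ring
  simp only [smallG, stepWeight, e1, e2]

lemma kernelH_eq (H t s : ℝ) :
    kernelH H t s = cH H * (H - 1 / 2) * (s ^ (-(H - 1 / 2)) *
      ∫ u in s..t, u ^ (H - 1 / 2) * (u - s) ^ (H - 1 / 2 - 1)) := by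
  have e1 : (1 : ℝ) / 2 - H = -(H - 1 / 2) := by ring
  have e2 : H - 3 / 2 = H - 1 / 2 - 1 := by ring
  simp only [kernelH, e1, e2, mul_assoc]

lemma intervalIntegrable_kernel {a : ℝ} (ha : 0 < a) (x u w : ℝ) :
    IntervalIntegrable (fun v : ℝ => v ^ a * (v - x) ^ (a - 1)) volume u w := by
  simpa using intervalIntegrable_volterra ha 0 x u w

/-- The kernel is homogeneous. -/
lemma kernelH_div {H t x c : ℝ} (hc : 0 < c) (hx : 0 < x) (hxt : x ≤ t) :
    kernelH H (t / c) (x / c) = c ^ (-(H - 1 / 2)) * kernelH H t x := by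
  rw [kernelH_eq, kernelH_eq]
  set a := H - 1 / 2
  have hsub := intervalIntegral.integral_comp_div (a := x) (b := t)
    (fun u => u ^ a * (u - x / c) ^ (a - 1)) hc.ne'
  have hcongr : ∫ u in x..t, (u / c) ^ a * (u / c - x / c) ^ (a - 1) =
      ∫ u in x..t, c ^ (-a) * c ^ (1 - a) * (u ^ a * (u - x) ^ (a - 1)) := by
    refine intervalIntegral.integral_congr fun u hu => ?_
    rw [uIcc_of_le hxt] at hu
    have h0 := hu.1
    rw [← sub_div, Real.div_rpow (by linarith) hc.le, Real.div_rpow (by linarith) hc.le,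
      Real.rpow_neg hc.le, show 1 - a = -(a - 1) by ring, Real.rpow_neg hc.le]
    field_simp
  rw [hcongr, intervalIntegral.integral_const_mul, smul_eq_mul] at hsub
  have hI : ∫ u in (x / c)..(t / c), u ^ a * (u - x / c) ^ (a - 1) =
      c⁻¹ * (c ^ (-a) * c ^ (1 - a) * ∫ u in x..t, u ^ a * (u - x) ^ (a - 1)) := by
    rw [hsub, inv_mul_cancel_left₀ hc.ne']
  rw [hI, Real.div_rpow hx.le hc.le, sub_eq_add_neg 1 a, Real.rpow_add hc, Real.rpow_one,
    Real.rpow_neg hc.le]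
  have := Real.rpow_pos_of_pos hc a
  field_simp

lemma kernelH_sub {H m x : ℝ} (hH : 1 / 2 < H) :
    kernelH H (m + 1) x - kernelH H m x =
      cH H * (H - 1 / 2) * (x ^ (-(H - 1 / 2)) * volterraIncr (H - 1 / 2) m x) := by
  have ha : 0 < H - 1 / 2 := by linarith
  rw [kernelH_eq, kernelH_eq, ← mul_sub, ← mul_sub, intervalIntegral.integral_interval_sub_left
    (intervalIntegrable_kernel ha x _ _) (intervalIntegrable_kernel ha x _ _), volterraIncr,
    intervalIntegral.integral_comp_add_right
      (fun u => u ^ (H - 1 / 2) * (u - x) ^ (H - 1 / 2 - 1)), zero_add, add_comm 1 m]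

/-- Substitute `u = (t - x) y + x`; at `x = t` both sides vanish. -/
lemma kernelH_eq_stepInner {H t x : ℝ} (hH : 1 / 2 < H) (hxt : x ≤ t) :
    kernelH H t x = cH H * (H - 1 / 2) * (x ^ (-(H - 1 / 2)) * (t - x) ^ (H - 1 / 2) *
      ∫ y in (0 : ℝ)..1, (y * (t - x) + x) ^ (H - 1 / 2) * y ^ (H - 1 / 2 - 1)) := by
  rw [kernelH_eq, mul_assoc (x ^ _)]
  set a := H - 1 / 2 with ha
  have ha0 : 0 < a := by linarith
  congr 2
  rcases eq_or_lt_of_le hxt with rfl | hlt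
  · simp [Real.zero_rpow ha0.ne']
  have hd : 0 < t - x := sub_pos.2 hlt
  have hsub := intervalIntegral.smul_integral_comp_mul_add (a := 0) (b := 1)
    (fun u => u ^ a * (u - x) ^ (a - 1)) (t - x) x
  rw [mul_zero, zero_add, mul_one, sub_add_cancel, smul_eq_mul] at hsub
  rw [← hsub, ← intervalIntegral.integral_const_mul, ← intervalIntegral.integral_const_mul]
  refine intervalIntegral.integral_congr fun y hy => ?_
  rw [uIcc_of_le zero_le_one] at hy
  rw [add_sub_cancel_right, Real.mul_rpow hd.le hy.1, mul_comm (t - x) y,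
    Real.rpow_sub_one hd.ne']
  field_simp

/-- The three factors come from the prefactor, the change of variables and the homogeneity of the
kernel. -/
lemma scaling_exponent {N H : ℝ} (hN : 0 < N) :
    Real.sqrt N * N⁻¹ * N ^ (-(H - 1 / 2)) = N ^ (-H) := by
  rw [Real.sqrt_eq_rpow, ← Real.rpow_neg_one, ← Real.rpow_add hN, ← Real.rpow_add hN]
  ring_nf

/-- Rescaling an integral over a mesh interval. -/
lemma scaled_integral {N H σ : ℝ} (hN : 0 < N) {u w : ℝ} (huw : u ≤ w) (f h : ℝ → ℝ)
    (hfh : ∀ x ∈ Ioc u w, f (x / N) = N ^ (-(H - 1 / 2)) * (cH H * (H - 1 / 2) * h x)) :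
    σ * Real.sqrt N * ∫ x in (u / N)..(w / N), f x =
      N ^ (-H) * (σ * (cH H * (H - 1 / 2)) * ∫ x in u..w, h x) := by
  have hsub := intervalIntegral.integral_comp_div (a := u) (b := w) f hN.ne'
  have hI : ∫ x in (u / N)..(w / N), f x = N⁻¹ * ∫ x in u..w, f (x / N) := by
    rw [hsub, smul_eq_mul]; field_simp
  have hcongr : ∫ x in u..w, f (x / N) =
      ∫ x in u..w, N ^ (-(H - 1 / 2)) * (cH H * (H - 1 / 2) * h x) := by
    rw [intervalIntegral.integral_of_le huw, intervalIntegral.integral_of_le huw]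
    exact setIntegral_congr_fun measurableSet_Ioc hfh
  rw [hI, hcongr, intervalIntegral.integral_const_mul, intervalIntegral.integral_const_mul,
    ← scaling_exponent (H := H) hN]
  ring

lemma bigJ_eq (σ : ℝ) {H : ℝ} (hH : 1 / 2 < H) {N n i : ℕ} (hN : 0 < N) (hi : 1 ≤ i)
    (hin : i < n) : bigJ σ H N n i = (N : ℝ) ^ (-H) * smallJ σ H n i := by
  have hi' : (1 : ℝ) ≤ i := by exact_mod_cast hi
  have hin' : (i : ℝ) + 1 ≤ n := by exact_mod_cast hin
  have hN' : (0 : ℝ) < N := by exact_mod_cast hN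
  rw [smallJ_eq, bigJ, walkWeight]
  refine scaled_integral hN' (by linarith) _ _ fun x hx => ?_
  have h0 := hx.1
  have h1 := hx.2
  have hsub := kernelH_sub (H := H) (m := (n : ℝ) - 1) (x := x) hH
  rw [sub_add_cancel] at hsub
  rw [kernelH_div hN' (by linarith) (by linarith), kernelH_div hN' (by linarith) (by linarith),
    ← mul_sub, hsub]

lemma bigG_eq (σ : ℝ) {H : ℝ} (hH : 1 / 2 < H) {N n : ℕ} (hN : 0 < N) (hn : 1 ≤ n) :
    bigG σ H N n = (N : ℝ) ^ (-H) * smallG σ H n := by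
  have hn' : (1 : ℝ) ≤ n := by exact_mod_cast hn
  have hN' : (0 : ℝ) < N := by exact_mod_cast hN
  rw [smallG_eq, bigG, stepWeight]
  refine scaled_integral hN' (by linarith) _ _ fun x hx => ?_
  have h0 := hx.1
  rw [kernelH_div hN' (by linarith) hx.2, kernelH_eq_stepInner hH hx.2]

end Scaling

/-! ### Arbitrage points, conditional bounds and the conclusions. -/

section Main

/-- A large value of the rescaled walk along a path produces an arbitrage point. -/
lemma mem_arbitragePaths {σ H : ℝ} (hH : 1 / 2 < H) {a : ℝ → ℝ} {N n : ℕ} (hn : 1 ≤ n)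
    (hnN : n ≤ N) {x : SignPath (N - 1)} {y : ℕ → ℝ}
    (hy : ∀ i : Fin (N - 1), y i = (((x i : ℤˣ) : ℤ) : ℝ))
    (hdrift : (N : ℝ) ^ H * |drift a N n| ≤ 1)
    (hlarge : smallG σ H n + 1 ≤ |∑ i ∈ Finset.range (n - 1), smallJ σ H n (i + 1) * y i|) :
    x ∈ arbitragePaths σ a H N := by
  have hN : 0 < N := by omega
  have hN' : (0 : ℝ) < N := by exact_mod_cast hN
  have hNH : 0 < (N : ℝ) ^ H := Real.rpow_pos_of_pos hN' _
  refine ⟨n, ⟨hn, hnN⟩, ?_⟩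
  set S := ∑ i ∈ Finset.range (n - 1), smallJ σ H n (i + 1) * y i with hS
  have hY : bigY σ H N n (fun i => x (Fin.castLE (Nat.sub_le_sub_right hnN 1) i)) =
      (N : ℝ) ^ (-H) * S := by
    rw [bigY, hS, Finset.sum_range, Finset.mul_sum]
    refine Finset.sum_congr rfl fun i _ => ?_
    have := hy (Fin.castLE (Nat.sub_le_sub_right hnN 1) i)
    rw [bigJ_eq σ hH hN (by omega) (by omega), ← this, Fin.val_castLE, mul_assoc]
  simp only [arbitragePoints, upValue, downValue, mem_ofPred_eq]
  rw [hY, bigG_eq σ hH hN hn, ← mul_add, ← mul_sub, Real.rpow_neg hN'.le]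
  -- Multiplied by `N^H`, the drift has modulus at most `1`, which the surplus `1` in `hlarge`
  -- absorbs.
  rw [← abs_of_pos hNH, ← abs_mul, abs_le] at hdrift
  rcases le_abs.1 hlarge with h | h
  · right
    rw [← div_eq_inv_mul, le_div_iff₀ hNH]
    linarith
  · left
    rw [← div_eq_inv_mul, div_le_iff₀ hNH]
    linarith

/-- The statement on proportions mentions no probability space; this one turns counting paths into a
probability. -/
lemma exists_isIIDSigns : ∃ (Ω : Type) (_ : MeasurableSpace Ω) (P : Measure Ω) (ξ : ℕ → Ω → ℝ),
    IsProbabilityMeasure P ∧ IsIIDSigns ξ P := by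
  let μ : Measure ℝ := (1 / 2 : ENNReal) • Measure.dirac 1 + (1 / 2 : ENNReal) • Measure.dirac (-1)
  have hμ : IsProbabilityMeasure μ := ⟨by simp [μ, ENNReal.inv_two_add_inv_two]⟩
  obtain ⟨Ω, mΩ, P, ξ, hm, hlaw, hind, hP⟩ := exists_iid ℕ μ
  have hprob : ∀ (k : ℕ) (c : ℝ), P {ω | ξ k ω = c} = μ {c} := fun k c => by
    rw [← (hlaw k).map_eq, Measure.map_apply (hm k) (measurableSet_singleton c)]
    rfl
  refine ⟨Ω, mΩ, P, ξ, hP, hm, hind, fun k => ?_, fun k => ?_⟩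
  · rw [hprob]
    have : ¬ (-1 : ℝ) = 1 := by norm_num
    simp [μ, this]
  · rw [hprob]
    have : ¬ (1 : ℝ) = -1 := by norm_num
    simp [μ, this]

variable {σ H : ℝ}

/-- The conditional probability of a large value of the rescaled walk is bounded below. -/
lemma exists_cond_large (hσ : 0 < σ) (hH : 1 / 2 < H) (hH1 : H < 1) :
    ∃ (T δ : ℝ), 0 < δ ∧ δ ≤ 1 ∧ (∀ n ≥ 2, smallG σ H n + 1 ≤ T) ∧
      ∀ {Ω : Type*} [MeasurableSpace Ω] {P : Measure Ω} [IsProbabilityMeasure P]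
        {ξ : ℕ → Ω → ℝ}, IsIIDSigns ξ P → ∀ m, ∃ n₀, ∀ n ≥ n₀, ∀ G,
          MeasurableSet[coordSigma ξ (Iio m)] G →
            δ * P.real G ≤ P.real (G ∩ {ω | T ≤ |walkY ξ σ H n ω|}) := by
  have ha : 0 < H - 1 / 2 := by linarith
  have hK : 0 < σ * (cH H * (H - 1 / 2)) := mul_pos hσ (mul_pos (cH_pos hH hH1) ha)
  set K := σ * (cH H * (H - 1 / 2)) with hKdef
  -- After multiplication by `K`, the last `L` coefficients add up to at least the upper bound `K ·
  -- 2/a` of the barrier plus `1`.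
  obtain ⟨L, -, hL⟩ := exists_le_sum_last_weights ha (by linarith)
    ((K * (2 / (H - 1 / 2)) + 1) / K)
  refine ⟨K * (2 / (H - 1 / 2)) + 1, (1 / 2) ^ L, by positivity,
    pow_le_one₀ (by norm_num) (by norm_num), fun n hn => ?_, fun h m => ?_⟩
  · rw [smallG_eq]
    gcongr
    exact stepWeight_le ha (by linarith) hn
  · refine h.prob_le_abs_sum (fun n i => smallJ σ H n (i + 1)) (n₁ := L + 2) (fun n hn => ?_) m
    have := (div_le_iff₀' hK).1 (hL n hn)
    rw [Finset.mul_sum] at this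
    simpa only [smallJ_eq] using this

/-- The conditional probability of a small value of the rescaled walk is bounded below. -/
lemma exists_cond_small (hσ : 0 < σ) (hH : 1 / 2 < H) (hH1 : H < 1) :
    ∃ δ : ℝ, 0 < δ ∧ δ ≤ 1 ∧
      ∀ {Ω : Type*} [MeasurableSpace Ω] {P : Measure Ω} [IsProbabilityMeasure P]
        {ξ : ℕ → Ω → ℝ}, IsIIDSigns ξ P → ∀ m, ∃ n₀, ∀ n ≥ n₀, ∀ G,
          MeasurableSet[coordSigma ξ (Iio m)] G →
            δ * P.real G ≤ P.real (G ∩ {ω | |walkY ξ σ H n ω| ≤ smallG σ H n}) := by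
  have ha : 0 < H - 1 / 2 := by linarith
  have ha1 : H - 1 / 2 < 1 / 2 := by linarith
  have hK : 0 < σ * (cH H * (H - 1 / 2)) := mul_pos hσ (mul_pos (cH_pos hH hH1) ha)
  set K := σ * (cH H * (H - 1 / 2)) with hKdef
  obtain ⟨V, hV⟩ := sum_sq_walkWeight_le ha ha1
  have hV0 : 0 ≤ V := by simpa using hV 2 0 le_rfl
  -- This choice satisfies `2 K² V ≤ M²`, as Chebyshev's inequality requires, because `2t ≤ (t +
  -- 1)²`.
  set M := K ^ 2 * V + 1 with hM
  have hKV : 0 ≤ K ^ 2 * V := by positivity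
  -- `1 ≤ L` places the last weight, which the square-sum bound does not cover, in the steered
  -- block.
  obtain ⟨L, hL1, hL⟩ := exists_le_sum_last_weights ha (by linarith) ((M + 1) / K)
  refine ⟨(1 / 2) ^ (L + 1), by positivity, pow_le_one₀ (by norm_num) (by norm_num),
    fun h m => ?_⟩
  refine h.prob_abs_sum_le (fun n i => smallJ σ H n (i + 1)) (smallG σ H) (V := K ^ 2 * V)
    (M := M) (n₁ := 8 * (L + 1)) (by linarith) (by nlinarith) (fun n hn => ?_) (fun n hn l => ?_)
    (fun n hn l => ?_) (fun n hn => ?_) (fun m => ?_) (fun n hn => ?_) m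
  · have := (div_le_iff₀' hK).1 (hL n (by omega))
    rw [Finset.mul_sum] at this
    simpa only [smallJ_eq] using this
  · have hl := l.2
    rw [smallJ_eq]
    exact mul_nonneg hK.le (walkWeight_nonneg _ (by omega) (by omega))
  · rw [smallJ_eq, smallG_eq]
    refine mul_le_mul_of_nonneg_left ?_ hK.le
    exact (last_weights_le ha ha1.le hn l.2).trans (le_stepWeight ha (by linarith) (by omega))
  · rw [Finset.sum_congr rfl fun i _ => show smallJ σ H n (i + 1) ^ 2 =
      K ^ 2 * walkWeight (H - 1 / 2) n (i + 1) ^ 2 by rw [smallJ_eq, mul_pow], ← Finset.mul_sum]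
    exact mul_le_mul_of_nonneg_left (hV n _ (by omega)) (by positivity)
  · have htend : Tendsto (fun n : ℕ => ∑ i ∈ Finset.range m, |smallJ σ H n (i + 1)|) atTop
        (𝓝 (∑ i ∈ Finset.range m, |K * 0|)) := by
      simp only [smallJ_eq]
      exact tendsto_finsetSum _ fun i _ =>
        ((tendsto_walkWeight ha ha1 (by omega)).const_mul K).abs
    simp only [mul_zero, abs_zero, Finset.sum_const_zero] at htend
    exact htend.eventually_le_const one_pos
  · rw [smallG_eq]
    refine mul_nonneg hK.le (le_trans ?_ (le_stepWeight ha (by linarith) (by omega)))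
    positivity

lemma measurable_walkY {Ω : Type*} (ξ : ℕ → Ω → ℝ) (σ H : ℝ) (n : ℕ) :
    Measurable[coordSigma ξ (Iio n)] (walkY ξ σ H n) :=
  measurable_sum_coordSigma (fun i => smallJ σ H n (i + 1)) _ fun i hi => by
    rw [Finset.mem_range] at hi; simp only [mem_Iio]; omega

variable {Ω : Type*} [MeasurableSpace Ω] {P : Measure Ω} [IsProbabilityMeasure P] {ξ : ℕ → Ω → ℝ}

/-- For every Hurst index in `(1/2, 1)` the rescaled walk leaves `[-g_n, g_n]` infinitely often,
almost surely. -/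
theorem prob_infinitelyOften_eq_one (h : IsIIDSigns ξ P) (hσ : 0 < σ) (hH : 1 / 2 < H)
    (hH1 : H < 1) :
    P (infinitelyOften fun n => {ω | |walkY ξ σ H n ω| > smallG σ H n}) = 1 := by
  obtain ⟨T, δ, hδ, hδ1, hT, hcond⟩ := exists_cond_large hσ hH hH1
  have hmeas : ∀ n, Measurable (walkY ξ σ H n) := fun n =>
    (measurable_walkY ξ σ H n).mono (h.coordSigma_le _) le_rfl
  have hset : MeasurableSet
      (infinitelyOften fun n => {ω | |walkY ξ σ H n ω| > smallG σ H n}) :=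
    MeasurableSet.iInter fun n => MeasurableSet.iInter fun _ => MeasurableSet.iUnion fun k =>
      MeasurableSet.iUnion fun _ => measurableSet_lt measurable_const (hmeas k).abs
  have hzero := fun n₀ => prob_iInter_compl_eq_zero h (A := fun n => {ω | T ≤ |walkY ξ σ H n ω|})
    hδ hδ1 (fun n => (measurable_walkY ξ σ H n)
      (measurableSet_le measurable_const measurable_id.abs : MeasurableSet {y : ℝ | T ≤ |y|}))
    (hcond h) n₀
  rw [← mem_ae_iff_prob_eq_one hset]
  have hall : ∀ᵐ ω ∂P, ∀ n₀, ω ∉ ⋂ n ≥ n₀, {ω | T ≤ |walkY ξ σ H n ω|}ᶜ :=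
    ae_all_iff.2 fun n₀ => measure_eq_zero_iff_ae_notMem.1 (hzero n₀)
  filter_upwards [hall] with ω hω
  refine mem_iInter₂.2 fun n hn => ?_
  -- The bound of the barrier by `T` is available only from level `2` on.
  have := hω (max n 2)
  simp only [mem_iInter, mem_compl_iff, mem_ofPred_eq, not_forall, not_not] at this
  obtain ⟨k, hk, hk'⟩ := this
  have h2 := hT k (le_trans (le_max_right _ _) hk)
  exact mem_iUnion₂.2 ⟨k, le_trans (le_max_left _ _) hk, show smallG σ H k < _ by linarith⟩

/-- For every Hurst index in `(1/2, 1)` the rescaled walk returns to `[-g_n, g_n]` infinitely often,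
almost surely. -/
theorem prob_ultimately_eq_zero (h : IsIIDSigns ξ P) (hσ : 0 < σ) (hH : 1 / 2 < H)
    (hH1 : H < 1) :
    P (ultimately fun n => {ω | |walkY ξ σ H n ω| > smallG σ H n}) = 0 := by
  obtain ⟨δ, hδ, hδ1, hcond⟩ := exists_cond_small hσ hH hH1
  have hzero := fun n₀ => prob_iInter_compl_eq_zero h
    (A := fun n => {ω | |walkY ξ σ H n ω| ≤ smallG σ H n})
    hδ hδ1 (fun n => (measurable_walkY ξ σ H n)
      (measurableSet_le measurable_id.abs measurable_const :
        MeasurableSet {y : ℝ | |y| ≤ smallG σ H n})) (hcond h) n₀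
  refine measure_iUnion_null fun n => measure_iUnion_null fun _ => ?_
  refine measure_mono_null (fun ω hω => ?_) (hzero n)
  rw [mem_iInter₂] at hω ⊢
  intro k hk hle
  have hgt : smallG σ H k < |walkY ξ σ H k ω| := hω k hk
  exact hgt.not_ge hle

/-- A set of paths has as its proportion the probability that the signs follow one of them. -/
lemma IsIIDSigns.prob_iUnion_pattern (h : IsIIDSigns ξ P) (L : ℕ) (B : Set (Fin L → ℤˣ)) :
    P.real (⋃ x ∈ B, patternEvent ξ 0 L x) = (B.ncard : ℝ) / 2 ^ L := by
  classical
  have hB : (⋃ x ∈ B, patternEvent ξ 0 L x) =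
      ⋃ x ∈ (B.toFinite.toFinset), patternEvent ξ 0 L x := by simp
  rw [hB, measureReal_biUnion_finset (fun x _ y _ hxy => disjoint_patternEvent ξ 0 L hxy)
    (fun x _ => h.coordSigma_le _ _ (measurableSet_patternEvent ξ 0 L x)),
    Finset.sum_congr rfl (g := fun _ => (1 / 2 : ℝ) ^ L)]
  · rw [Finset.sum_const, nsmul_eq_mul, ← Set.ncard_eq_toFinset_card, one_div, inv_pow,
      div_eq_mul_inv]
  · intro x _
    rw [measureReal_def, h.prob_pattern]
    simp

/-- A continuous function on `[0, 1]` is bounded, so the rescaled drift is `O(N^(H-1))` uniformly in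
`n`. -/
lemma eventually_drift_le {a : ℝ → ℝ} (ha : ContinuousOn a (Icc 0 1)) (hH1 : H < 1) :
    ∀ᶠ N : ℕ in atTop, ∀ n ≤ N, (N : ℝ) ^ H * |drift a N n| ≤ 1 := by
  obtain ⟨B, hB⟩ := isCompact_Icc.exists_bound_of_continuousOn ha
  have htend : Tendsto (fun N : ℕ => (N : ℝ) ^ (-(1 - H)) * B) atTop (𝓝 (0 * B)) :=
    (((tendsto_rpow_neg_atTop (by linarith : 0 < 1 - H)).comp
      tendsto_natCast_atTop_atTop)).mul_const B
  rw [zero_mul] at htend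
  filter_upwards [htend.eventually_le_const one_pos, eventually_gt_atTop 0] with N hN hN0 n hn
  have hN' : (0 : ℝ) < N := by exact_mod_cast hN0
  have hnN : (n : ℝ) ≤ N := by exact_mod_cast hn
  have hb := hB ((n : ℝ) / N) ⟨by positivity, (div_le_one hN').2 hnN⟩
  rw [Real.norm_eq_abs] at hb
  refine le_trans ?_ hN
  rw [drift, abs_mul, abs_of_pos (by positivity : (0 : ℝ) < 1 / N), ← mul_assoc]
  have : (N : ℝ) ^ H * (1 / N) = (N : ℝ) ^ (-(1 - H)) := by
    rw [neg_sub, Real.rpow_sub_one hN'.ne']; ring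
  rw [this]
  gcongr

/-- For every Hurst index in `(1/2, 1)` the proportion of arbitrage paths tends to one. -/
theorem tendsto_proportion_arbitragePaths (hσ : 0 < σ) (hH : 1 / 2 < H) (hH1 : H < 1)
    {a : ℝ → ℝ} (ha : ContinuousOn a (Icc 0 1)) :
    Tendsto (fun N : ℕ => ((arbitragePaths σ a H N).ncard : ℝ) / 2 ^ (N - 1)) atTop (𝓝 1) := by
  obtain ⟨Ω, mΩ, P, ξ, hP, h⟩ := exists_isIIDSigns
  obtain ⟨T, δ, hδ, hδ1, hT, hcond⟩ := exists_cond_large hσ hH hH1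
  have hsplit : ∀ N : ℕ, ((arbitragePaths σ a H N).ncard : ℝ) / 2 ^ (N - 1) =
      1 - ((arbitragePaths σ a H N)ᶜ.ncard : ℝ) / 2 ^ (N - 1) := by
    intro N
    have hadd := Set.ncard_add_ncard_compl (arbitragePaths σ a H N)
    rw [Nat.card_eq_fintype_card, Fintype.card_fun, Fintype.card_units_int, Fintype.card_fin]
      at hadd
    have hadd' : ((arbitragePaths σ a H N).ncard : ℝ) + ((arbitragePaths σ a H N)ᶜ.ncard : ℝ) =
        2 ^ (N - 1) := by exact_mod_cast hadd
    rw [eq_sub_iff_add_eq, ← add_div, hadd', div_self (by positivity)]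
  have hbad : Tendsto (fun N : ℕ => ((arbitragePaths σ a H N)ᶜ.ncard : ℝ) / 2 ^ (N - 1)) atTop
      (𝓝 0) := by
    refine tendsto_order.2 ⟨fun c hc => Eventually.of_forall fun N =>
      hc.trans_le (by positivity), fun c hc => ?_⟩
    obtain ⟨k, hk⟩ := exists_pow_lt_of_lt_one hc (by linarith : 1 - δ < 1)
    obtain ⟨N₀, hN₀⟩ := exists_prob_iInter_compl_le h
      (A := fun n => {ω | T ≤ |walkY ξ σ H n ω|}) hδ1 (fun n => (measurable_walkY ξ σ H n)
      (measurableSet_le measurable_const measurable_id.abs : MeasurableSet {y : ℝ | T ≤ |y|}))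
      (hcond h) 2 k
    filter_upwards [eventually_ge_atTop N₀, eventually_drift_le ha hH1] with N hN hdrift
    refine lt_of_le_of_lt ?_ (hN₀.trans_lt hk)
    rw [← h.prob_iUnion_pattern]
    -- Signs following a path without arbitrage cannot have `|walkY| ≥ T` at any level in `[2, N₀)`.
    -- Since `N₀` does not depend on `N`, all these levels are available once `N ≥ N₀`.
    refine measureReal_mono fun ω hω => ?_
    obtain ⟨x, hx, hωx⟩ := mem_iUnion₂.1 hω
    refine mem_iInter₂.2 fun n hn hTn => hx ?_
    rw [Finset.mem_Ico] at hn
    have hTn' : T ≤ |walkY ξ σ H n ω| := hTn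
    refine mem_arbitragePaths hH (n := n) (by omega) (by omega) (y := fun i => ξ i ω)
      (fun i => ?_) (hdrift n (by omega)) ((hT n hn.1).trans hTn')
    have := hωx i
    rwa [zero_add] at this
  simp_rw [hsplit]
  simpa using hbad.const_sub 1

end Main

end FractionalBinaryMarket

theorem theorem3p4 :
    ∃ Hc : ℝ, 1 / 2 < Hc ∧ Hc < 1 ∧
      ∀ σ : ℝ, 0 < σ →
        (∀ (Ω : Type*) [MeasurableSpace Ω] (P : Measure Ω) [IsProbabilityMeasure P]
            (ξ : ℕ → Ω → ℝ), FractionalBinaryMarket.IsIIDSigns ξ P →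
          (∀ H : ℝ, Hc < H → H < 1 →
            P (FractionalBinaryMarket.infinitelyOften fun n =>
              {ω | |FractionalBinaryMarket.walkY ξ σ H n ω|
                > FractionalBinaryMarket.smallG σ H n}) = 1) ∧
          (∀ H : ℝ, 1 / 2 < H → H < Hc →
            P (FractionalBinaryMarket.ultimately fun n =>
              {ω | |FractionalBinaryMarket.walkY ξ σ H n ω|
                > FractionalBinaryMarket.smallG σ H n}) = 0)) ∧
        (∀ a : ℝ → ℝ, ContinuousOn a (Set.Icc 0 1) →
          ∀ H : ℝ, Hc < H → H < 1 →
            Tendsto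
              (fun N : ℕ =>
                ((FractionalBinaryMarket.arbitragePaths σ a H N).ncard : ℝ) / 2 ^ (N - 1))
              atTop (𝓝 1)) := by
  -- The value `3/4` is arbitrary: all three conclusions hold throughout `(1/2, 1)`.
  refine ⟨3 / 4, by norm_num, by norm_num, fun σ hσ => ⟨fun Ω _ P _ ξ h => ⟨?_, ?_⟩, ?_⟩⟩
  · exact fun H hH hH1 =>
      FractionalBinaryMarket.prob_infinitelyOften_eq_one h hσ (by linarith) hH1
  · exact fun H hH hH1 =>
      FractionalBinaryMarket.prob_ultimately_eq_zero h hσ hH (by linarith)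
  · exact fun a ha H hH hH1 =>
      FractionalBinaryMarket.tendsto_proportion_arbitragePaths hσ (by linarith) hH1 ha
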